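/- Theorem 1.4. All graphs are finite and simple. Let \(\eta>0\) and let \(H\) be a graph with chromatic number \(\chi(H)=r\ge 2\). Let \(h:=|H|\) be the number of vertices of \(H\), let \(\sigma:=\sigma(H)\) be the smallest possible size of a colour class over all proper colourings of \(H\) with \(\chi(H)\) colours, and let \(\omega:=(h-\sigma)/(r-1)\). Then there exists \(n_0=n_0(\eta,H)\in\mathbb N\) such that the following holds. Suppose \(G\) is a graph on \(n\ge n_0\) vertices with degree sequence \(d_1\le d_2\le\dots\le d_n\) such that \[d_i\ \ge\ \Bigl(1-\frac{\omega+\sigma}{h}\Bigr)n+\frac{\sigma}{\omega}\,i\qquad\text{for all integers } i \text{ with } 1\le i\le \frac{\omega n}{h}.\] Then \(G\) contains an \(H\)-tiling, i.e. a collection of pairwise vertex-disjoint (not necessarily induced) copies of \(H\) in \(G\), covering all but at most \(\eta n\) vertices of \(G\). -/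

import Mathlib

namespace SimpleGraph

/-- The invariant `σ(H)`: the smallest size of a colour class over all proper colourings of `H`
with `χ(H)` colours. -/
noncomputable def minColorClassSize {W : Type*} (H : SimpleGraph W) : ℕ :=
  sInf {m : ℕ | ∃ (C : H.Coloring (Fin H.chromaticNumber.toNat))
    (c : Fin H.chromaticNumber.toNat), m = (C.colorClass c).ncard}

/-- `d 1 ≤ d 2 ≤ ⋯ ≤ d n` is the degree sequence of the graph `G` on `n` vertices: the values
`d 1, …, d n` are nondecreasing and are, with multiplicity, the degrees of the vertices of `G`.
Values of `d` outside `{1, …, n}` play no role. -/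
def IsDegreeSequence {V : Type*} [Fintype V] (G : SimpleGraph V) [DecidableRel G.Adj]
    (d : ℕ → ℕ) : Prop :=
  MonotoneOn d (Set.Icc 1 (Fintype.card V)) ∧
    (Finset.Icc 1 (Fintype.card V)).val.map d =
      (Finset.univ : Finset V).val.map (fun v => G.degree v)

/-- An `H`-tiling in `G`: a collection of pairwise vertex-disjoint copies of `H` in `G`, that is,
of (not necessarily induced) subgraphs of `G` isomorphic to `H`. -/
structure IsTiling {W V : Type*} (H : SimpleGraph W) (G : SimpleGraph V)
    (T : Set G.Subgraph) : Prop where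
  copy : ∀ B ∈ T, Nonempty (H ≃g B.coe)
  disjoint : T.PairwiseDisjoint Subgraph.verts

/-- The vertices of `G` covered by a collection of subgraphs. -/
def coveredVerts {V : Type*} {G : SimpleGraph V} (T : Set G.Subgraph) : Set V :=
  ⋃ B ∈ T, B.verts

end SimpleGraph

set_option linter.unusedSectionVars false

/-! Put `s = r - 1`. Take `s` disjoint copies of `H`, coloured so that a smallest class keeps its
colour while the other `s` classes rotate from copy to copy. Jointly they fit a complete `r`-partite
graph with one class of size `p = sσ` and `s` classes of size `q = h - σ`, where `p ≤ q`: a bottle.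
In terms of `M = sh = p + sq`, the slope `σ / ω` is `p / q`, and `(ω + σ) / h = (p + q) / M`. By
regularity it suffices to find an almost perfect fractional tiling of the reduced graph by
`r`-cliques weighted `p, q, …, q`; this is rounded down and realised greedily inside the clusters.

The fractional tiling comes from a linear programming argument. Take an optimal tiling whose set `F`
of unsaturated vertices is as large as possible. Weight can be exchanged between tiles without
losing optimality, so an unsaturated `x` misses mass at least `q` in every tile used, and at least
`p + q` unless the tile itself meets `F` (`IsSaturated.mass_le`). Averaging over tiles gives every
`x ∈ F` degree at most the uncovered weight plus the threshold in the degree condition for sets of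
size `|F|` (`IsSaturated.degIn_le`). If some vertex of `F` always has larger degree, `F` is empty: a
defect smaller than the surplus in the degrees improves to zero (`hasDefect_zero`).

To get started, and to absorb the error `g` that regularity introduces, universal vertices are added
(`hasDefect_of_degIn`). Each raises degrees by `1` but the threshold by at most `1 - q / M`. With
very many of them the defect is zero. Deleting one creates only a bounded defect, which heals as
long as `O(g + 1)` universal vertices remain; deleting those last ones costs `O(g + 1)`. In the
reduced graph `g` is a small multiple of the number of clusters. -/

section AlmostPerfectTiling

open Finset

/-! ### Fractional clique tilings: optimality, slack and exchange. -/

namespace FracTiling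

section Defs

variable {A ι : Type*} [Fintype ι] [DecidableEq A]

/-- The total weight that the map `φ` places on the vertex `a`, when index `i` carries `c i`. -/
def content (c : ι → ℝ) (φ : ι → A) (a : A) : ℝ := ∑ i, if φ i = a then c i else 0

/-- The images of `φ` lie in `S` and form a clique of `K`. -/
def IsTile (K : SimpleGraph A) (S : Finset A) (φ : ι → A) : Prop :=
  (∀ i, φ i ∈ S) ∧ ∀ i j, i ≠ j → K.Adj (φ i) (φ j)

/-- The total weight placed on the vertex `a` by a weighting `w` of the maps `ι → A`. -/
def load [Fintype A] [DecidableEq ι] (c : ι → ℝ) (w : (ι → A) → ℝ) (a : A) : ℝ :=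
  ∑ φ, w φ * content c φ a

/-- A fractional tiling of `S` by weighted cliques of `K`. -/
structure IsFracTiling [Fintype A] [DecidableEq ι] (K : SimpleGraph A) (c : ι → ℝ) (S : Finset A)
    (w : (ι → A) → ℝ) : Prop where
  nonneg : ∀ φ, 0 ≤ w φ
  tile : ∀ φ, w φ ≠ 0 → IsTile K S φ
  load_le : ∀ a, load c w a ≤ 1

/-- A fractional tiling of maximum total weight. -/
def IsOptimal [Fintype A] [DecidableEq ι] (K : SimpleGraph A) (c : ι → ℝ) (S : Finset A)
    (w : (ι → A) → ℝ) : Prop :=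
  IsFracTiling K c S w ∧ ∀ w', IsFracTiling K c S w' → ∑ φ, w' φ ≤ ∑ φ, w φ

/-- An optimal fractional tiling which leaves slack wherever some optimal one does. -/
def IsSaturated [Fintype A] [DecidableEq ι] (K : SimpleGraph A) (c : ι → ℝ) (S : Finset A)
    (w : (ι → A) → ℝ) : Prop :=
  IsOptimal K c S w ∧ ∀ w', IsOptimal K c S w' → ∀ a, load c w' a < 1 → load c w a < 1

end Defs

section Optimal

variable {A ι : Type*} [Fintype A] [DecidableEq A] [Fintype ι] [DecidableEq ι]
  {K : SimpleGraph A} {c : ι → ℝ} {S : Finset A} {w : (ι → A) → ℝ}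

lemma content_nonneg (hc : ∀ i, 0 ≤ c i) (φ : ι → A) (a : A) : 0 ≤ content c φ a :=
  sum_nonneg fun i _ => by split_ifs <;> simp [hc i]

lemma le_content (hc : ∀ i, 0 ≤ c i) (φ : ι → A) (i : ι) : c i ≤ content c φ (φ i) := by
  have := single_le_sum (f := fun k => if φ k = φ i then c k else 0)
    (fun k _ => by split_ifs <;> simp [hc k]) (mem_univ i)
  simpa [content] using this

lemma load_nonneg (hc : ∀ i, 0 ≤ c i) (hw : ∀ φ, 0 ≤ w φ) (a : A) : 0 ≤ load c w a :=
  sum_nonneg fun φ _ => mul_nonneg (hw φ) (content_nonneg hc φ a)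

lemma load_add (w w' : (ι → A) → ℝ) (a : A) :
    load c (w + w') a = load c w a + load c w' a := by
  simp [load, add_mul, sum_add_distrib]

lemma load_smul (t : ℝ) (w : (ι → A) → ℝ) (a : A) : load c (t • w) a = t * load c w a := by
  simp [load, mul_sum, mul_assoc]

lemma load_single (t : ℝ) (φ : ι → A) (a : A) :
    load c (Pi.single φ t) a = t * content c φ a := by
  simp only [load]
  rw [sum_eq_single φ (fun ψ _ h => by simp [h]) (by simp)]
  simp

/-- Double counting of weight by vertices and by tiles; applied with `g` constant, the indicator of
a neighbourhood, and the indicator of the slack set. -/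
lemma sum_load_mul (w : (ι → A) → ℝ) (g : A → ℝ) :
    ∑ a, load c w a * g a = ∑ φ, w φ * ∑ i, c i * g (φ i) := by
  simp only [load, content, sum_mul]
  rw [sum_comm]
  refine sum_congr rfl fun φ _ => ?_
  simp only [mul_assoc, ← mul_sum]
  congr 1
  simp only [sum_mul]
  rw [sum_comm]
  exact sum_congr rfl fun i _ => by simp

lemma IsFracTiling.weight_le (hw : IsFracTiling K c S w) (hc : ∀ i, 0 < c i) [Nonempty ι]
    (φ : ι → A) : w φ ≤ (c (Classical.arbitrary ι))⁻¹ := by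
  set i := Classical.arbitrary ι
  have h1 : w φ * content c φ (φ i) ≤ 1 :=
    (single_le_sum (f := fun ψ => w ψ * content c ψ (φ i)) (fun ψ _ =>
      mul_nonneg (hw.nonneg ψ) (content_nonneg (fun i => (hc i).le) ψ _)) (mem_univ φ)).trans
      (hw.load_le (φ i))
  have h2 := mul_le_mul_of_nonneg_left (le_content (fun i => (hc i).le) φ i) (hw.nonneg φ)
  rw [← one_div, le_div_iff₀ (hc i)]
  linarith

lemma exists_isOptimal [Nonempty ι] (hc : ∀ i, 0 < c i) : ∃ w, IsOptimal K c S w := by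
  have hcomp : IsCompact {w | IsFracTiling K c S w} := by
    refine (isCompact_Icc (a := (0 : (ι → A) → ℝ))
      (b := fun _ => (c (Classical.arbitrary ι))⁻¹)).of_isClosed_subset ?_
      fun w hw => ⟨hw.nonneg, hw.weight_le hc⟩
    have : {w | IsFracTiling K c S w} = (⋂ φ, {w | 0 ≤ w φ}) ∩
        ((⋂ φ, {w | w φ ≠ 0 → IsTile K S φ}) ∩ ⋂ a, {w | load c w a ≤ 1}) := by
      ext w
      simp only [Set.mem_ofPred_eq, Set.mem_inter_iff, Set.mem_iInter]
      exact ⟨fun h => ⟨h.1, h.2, h.3⟩, fun h => ⟨h.1, h.2.1, h.2.2⟩⟩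
    rw [this]
    refine (isClosed_iInter fun φ => isClosed_le continuous_const (continuous_apply φ)).inter
      ((isClosed_iInter fun φ => ?_).inter (isClosed_iInter fun a => ?_))
    · by_cases h : IsTile K S φ
      · simp [h]
      · simpa [h] using isClosed_eq (continuous_apply φ) continuous_const
    · refine isClosed_le ?_ continuous_const
      unfold load
      fun_prop
  obtain ⟨w, hw, hmax⟩ := hcomp.exists_isMaxOn
    ⟨0, ⟨fun _ => le_rfl, fun _ h => (h rfl).elim, fun a => by simp [load]⟩⟩
    (f := fun w => ∑ φ, w φ) (by fun_prop)
  exact ⟨w, hw, fun w' hw' => hmax hw'⟩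

lemma IsFracTiling.midpoint {w' : (ι → A) → ℝ} (hw : IsFracTiling K c S w)
    (hw' : IsFracTiling K c S w') : IsFracTiling K c S ((1 / 2 : ℝ) • (w + w')) := by
  refine ⟨fun φ => ?_, fun φ h => ?_, fun a => ?_⟩
  · have := hw.nonneg φ
    have := hw'.nonneg φ
    simp only [Pi.smul_apply, Pi.add_apply, smul_eq_mul]
    positivity
  · by_contra hn
    have h1 : w φ = 0 := by_contra fun h => hn (hw.tile φ h)
    have h2 : w' φ = 0 := by_contra fun h => hn (hw'.tile φ h)
    simp [h1, h2] at h
  · rw [load_smul, load_add]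
    linarith [hw.load_le a, hw'.load_le a]

/-- Among optimal tilings, choose one with the most slack vertices. Averaging it with another
optimal tiling stays optimal and has slack wherever either one does, so by maximality the other
contributes no new slack vertex. -/
lemma exists_isSaturated [Nonempty ι] (hc : ∀ i, 0 < c i) : ∃ w, IsSaturated K c S w := by
  classical
  let slack : ((ι → A) → ℝ) → Finset A := fun w => univ.filter fun a => load c w a < 1
  obtain ⟨w₀, hw₀⟩ := exists_isOptimal (K := K) (S := S) hc
  obtain ⟨F, hF, hmax⟩ := Set.exists_max_image {F | ∃ w, IsOptimal K c S w ∧ slack w = F} card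
    (Set.toFinite _) ⟨_, w₀, hw₀, rfl⟩
  obtain ⟨w, hw, rfl⟩ := hF
  refine ⟨w, hw, fun w' hw' a ha => ?_⟩
  have hsum : ∑ φ, w' φ = ∑ φ, w φ := le_antisymm (hw.2 _ hw'.1) (hw'.2 _ hw.1)
  have hm : IsOptimal K c S ((1 / 2 : ℝ) • (w + w')) := by
    refine ⟨hw.1.midpoint hw'.1, fun v hv => (hw.2 v hv).trans (le_of_eq ?_)⟩
    simp only [Pi.smul_apply, Pi.add_apply, smul_eq_mul, ← mul_sum, sum_add_distrib, hsum]
    ring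
  have hsub : slack w ⊆ slack ((1 / 2 : ℝ) • (w + w')) := fun b hb => by
    simp only [slack, mem_filter, mem_univ, true_and, load_smul, load_add] at hb ⊢
    linarith [hw'.1.load_le b]
  have heq := eq_of_subset_of_card_le hsub (hmax _ ⟨_, hm, rfl⟩)
  have ha' : a ∈ slack ((1 / 2 : ℝ) • (w + w')) := by
    simp only [slack, mem_filter, mem_univ, true_and, load_smul, load_add]
    linarith [hw.1.load_le a]
  rw [← heq] at ha'
  simpa [slack] using ha'

-- A small perturbation of the loads along `g` remains feasible: only vertices with slack may gain,
-- and as there are finitely many vertices one `δ` serves all.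
open Filter Topology in
lemma eventually_load_le (hw : IsFracTiling K c S w) {g : A → ℝ}
    (h : ∀ a, g a ≤ 0 ∨ load c w a < 1) :
    ∀ᶠ δ : ℝ in 𝓝[>] 0, ∀ a, load c w a + δ * g a ≤ 1 := by
  rw [eventually_all]
  intro a
  rcases h a with h | h
  · filter_upwards [self_mem_nhdsWithin] with δ hδ
    have : δ * g a ≤ 0 := mul_nonpos_of_nonneg_of_nonpos (le_of_lt hδ) h
    linarith [hw.load_le a]
  · have ht : Tendsto (fun δ : ℝ => load c w a + δ * g a) (𝓝 0) (𝓝 (load c w a)) := by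
      have : Continuous fun δ : ℝ => load c w a + δ * g a := by fun_prop
      simpa using this.tendsto 0
    exact ((ht.mono_left nhdsWithin_le_nhds).eventually_lt_const h).mono fun _ => le_of_lt

open Filter Topology in
/-- Shifting weight from a tile to another one which fits creates slack. -/
lemma IsSaturated.exchange {φ ψ : ι → A} (hw : IsSaturated K c S w) (hφ : 0 < w φ)
    (hψ : IsTile K S ψ) (h : ∀ a, content c ψ a ≤ content c φ a ∨ load c w a < 1) {a : A}
    (ha : content c ψ a < content c φ a) : load c w a < 1 := by
  -- Move weight `δ ≤ w φ` from `φ` to `ψ`. The total is unchanged, so the result is again optimal,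
  -- and saturation carries its slack at `a` back to `w`.
  obtain ⟨δ, hδ1, hδ2, hδ0⟩ := ((eventually_load_le (g := fun a => content c ψ a - content c φ a)
    hw.1.1 fun a => (h a).imp_left sub_nonpos.2).and
    (((eventually_le_nhds hφ).filter_mono nhdsWithin_le_nhds).and self_mem_nhdsWithin)).exists
  have hδ0 : 0 < δ := hδ0
  have hload : ∀ b, load c (w + (Pi.single ψ δ + Pi.single φ (-δ))) b =
      load c w b + δ * (content c ψ b - content c φ b) := fun b => by
    rw [load_add, load_add, load_single, load_single]
    ring
  have hopt : IsOptimal K c S (w + (Pi.single ψ δ + Pi.single φ (-δ))) := by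
    refine ⟨⟨fun θ => ?_, fun θ hθ => ?_, fun b => (hload b).le.trans (hδ1 b)⟩, fun v hv => ?_⟩
    · have := hw.1.1.nonneg θ
      simp only [Pi.add_apply, Pi.single_apply]
      split_ifs with h1 h2 h2 <;> subst_vars <;> linarith
    · by_contra hn
      have h0 : w θ = 0 := by_contra fun h => hn (hw.1.1.tile θ h)
      have h1 : θ ≠ ψ := fun h => hn (h ▸ hψ)
      have h2 : θ ≠ φ := fun h => hn (h ▸ hw.1.1.tile φ hφ.ne')
      simp [h0, h1, h2] at hθ
    · refine (hw.1.2 v hv).trans (le_of_eq ?_)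
      simp [sum_add_distrib]
  refine hw.2 _ hopt a ?_
  rw [hload]
  have : δ * (content c ψ a - content c φ a) < 0 :=
    mul_neg_of_pos_of_neg hδ0 (by linarith)
  linarith [hw.1.1.load_le a]

open Filter Topology in
/-- No tile has slack at all of its vertices. -/
lemma IsOptimal.not_forall_slack {ψ : ι → A} (hw : IsOptimal K c S w) (hψ : IsTile K S ψ) :
    ¬ ∀ i, load c w (ψ i) < 1 := by
  intro h
  have h' : ∀ a, content c ψ a ≤ 0 ∨ load c w a < 1 := fun a => by
    by_cases ha : ∃ i, ψ i = a
    · obtain ⟨i, rfl⟩ := ha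
      exact Or.inr (h i)
    · push Not at ha
      simp [content, ha]
  obtain ⟨δ, hδ1, hδ0⟩ := ((eventually_load_le hw.1 h').and self_mem_nhdsWithin).exists
  have hδ0 : 0 < δ := hδ0
  have hv : IsFracTiling K c S (w + Pi.single ψ δ) := by
    refine ⟨fun θ => ?_, fun θ hθ => ?_, fun b => ?_⟩
    · have := hw.1.nonneg θ
      simp only [Pi.add_apply, Pi.single_apply]
      split_ifs <;> linarith
    · by_contra hn
      have h0 : w θ = 0 := by_contra fun h => hn (hw.1.tile θ h)
      have h1 : θ ≠ ψ := fun h => hn (h ▸ hψ)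
      simp [h0, h1] at hθ
    · rw [load_add, load_single]
      exact hδ1 b
  have := hw.2 _ hv
  simp only [Pi.add_apply, sum_add_distrib, Finset.sum_pi_single', mem_univ, if_true] at this
  simp at this
  linarith

end Optimal
end FracTiling

/-! ### Bottle weights and the degrees of unsaturated vertices. -/

namespace FracTiling
open scoped Classical in
/-- The number of neighbours of `x` in `S`. -/
noncomputable def degIn {A : Type*} (K : SimpleGraph A) (S : Finset A) (x : A) : ℕ :=
  #{a ∈ S | K.Adj x a}

section Bottle

variable {A ι : Type*} [Fintype A] [DecidableEq A] [Fintype ι] [DecidableEq ι]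
  {K : SimpleGraph A} {c : ι → ℝ} {S : Finset A} {w : (ι → A) → ℝ}

/-- Weight `p` at the distinguished index `i₀` and weight `q` at the others. -/
def bottleWeight (i₀ : ι) (p q : ℝ) : ι → ℝ := fun i => if i = i₀ then p else q

lemma IsTile.injective {φ : ι → A} (h : IsTile K S φ) : Function.Injective φ := by
  intro i j hij
  by_contra hne
  exact (h.2 i j hne).ne hij

/-- Replacing one vertex of a tile by a vertex with slack creates slack at the old vertex. -/
lemma IsSaturated.load_lt_of_update (hw : IsSaturated K c S w) (hc : ∀ i, 0 < c i) {φ : ι → A}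
    (hφ : 0 < w φ) {x : A} (hxS : x ∈ S) (hx : load c w x < 1) {j : ι}
    (hadj : ∀ i, i ≠ j → K.Adj x (φ i)) : load c w (φ j) < 1 := by
  have hT := hw.1.1.tile φ hφ.ne'
  by_cases hxj : φ j = x
  · rwa [hxj]
  have hψ : IsTile K S (Function.update φ j x) := by
    refine ⟨fun i => ?_, fun i k hik => ?_⟩
    · by_cases h : i = j
      · subst h; simpa
      · simpa [h] using hT.1 i
    · by_cases h : i = j
      · subst h
        simpa [hik.symm] using hadj k hik.symm
      · by_cases h' : k = j
        · subst h'
          simpa [h] using (hadj i hik).symm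
        · simpa [h, h'] using hT.2 i k hik
  have hle : ∀ a, a ≠ x → ∀ i, (if Function.update φ j x i = a then c i else 0) ≤
      if φ i = a then c i else 0 := by
    intro a ha i
    by_cases h : i = j
    · subst h
      have := (hc i).le
      rw [Function.update_self, if_neg ha.symm]
      split_ifs <;> simp [this]
    · rw [Function.update_of_ne h]
  refine hw.exchange hφ hψ (fun a => ?_) (a := φ j) ?_
  · by_cases ha : a = x
    · exact Or.inr (ha ▸ hx)
    · exact Or.inl (sum_le_sum fun i _ => hle a ha i)
  · refine sum_lt_sum (fun i _ => hle _ hxj i) ⟨j, mem_univ j, ?_⟩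
    rw [Function.update_self, if_neg (Ne.symm hxj), if_pos rfl]
    exact hc j

/-- A tile of positive weight does not have slack at its distinguished vertex. -/
lemma IsSaturated.load_distinguished {p q : ℝ} (hpq : p < q) {i₀ : ι}
    (hw : IsSaturated K (bottleWeight i₀ p q) S w) {φ : ι → A} (hφ : 0 < w φ) :
    ¬ load (bottleWeight i₀ p q) w (φ i₀) < 1 := by
  intro h0
  have hT := hw.1.1.tile φ hφ.ne'
  refine hw.1.not_forall_slack hT fun j => ?_
  by_cases hj : j = i₀
  · rwa [hj]
  -- Swapping the roles of `i₀` and `j` puts the heavier `q` on `φ i₀`, which is assumed to have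
  -- slack, and lightens `φ j`. Hence every `φ j` has slack, against optimality.
  have hψ : IsTile K S (φ ∘ Equiv.swap i₀ j) :=
    ⟨fun i => hT.1 _, fun i k hik => hT.2 _ _ ((Equiv.swap i₀ j).injective.ne hik)⟩
  have hsum : ∀ a, content (bottleWeight i₀ p q) (φ ∘ Equiv.swap i₀ j) a =
      ∑ i, if φ i = a then bottleWeight i₀ p q (Equiv.swap i₀ j i) else 0 := fun a => by
    unfold content
    rw [← Equiv.sum_comp (Equiv.swap i₀ j)]
    simp
  have hle : ∀ a, a ≠ φ i₀ → ∀ i,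
      (if φ i = a then bottleWeight i₀ p q (Equiv.swap i₀ j i) else 0) ≤
      if φ i = a then bottleWeight i₀ p q i else 0 := by
    intro a ha i
    by_cases h1 : i = i₀
    · subst h1; simp [ha.symm]
    · by_cases h2 : i = j
      · subst h2
        simp only [bottleWeight, Equiv.swap_apply_right, if_true, h1, if_false]
        split_ifs <;> linarith
      · rw [Equiv.swap_apply_of_ne_of_ne h1 h2]
  refine hw.exchange hφ hψ (fun a => ?_) (a := φ j) ?_
  · by_cases ha : a = φ i₀
    · exact Or.inr (ha ▸ h0)
    · rw [hsum]
      exact Or.inl (sum_le_sum fun i _ => hle a ha i)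
  · rw [hsum]
    refine sum_lt_sum (fun i _ => hle _ (hT.injective.ne hj) i) ⟨j, mem_univ j, ?_⟩
    simpa [bottleWeight, hj] using hpq

-- If `x` were adjacent to the whole tile, it could replace each vertex in turn, giving slack
-- everywhere and contradicting optimality. Two non-neighbours have mass at least `p + q`. A single
-- non-neighbour can be replaced by `x`, so it has slack; it then has weight `q`, and the slack mass
-- of the tile pays for the missing `p`.
open scoped Classical in
lemma IsSaturated.mass_le {p q : ℝ} (hp : 0 < p) (hpq : p ≤ q) {i₀ : ι}
    (hw : IsSaturated K (bottleWeight i₀ p q) S w) {φ : ι → A} (hφ : 0 < w φ) {x : A}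
    (hxS : x ∈ S) (hx : load (bottleWeight i₀ p q) w x < 1) :
    (∑ i, if K.Adj x (φ i) then bottleWeight i₀ p q i else 0) ≤
        (∑ i, bottleWeight i₀ p q i) - q ∧
      (∑ i, if K.Adj x (φ i) then bottleWeight i₀ p q i else 0) ≤
        (∑ i, bottleWeight i₀ p q i) - p - q + p / q *
          ∑ i, if load (bottleWeight i₀ p q) w (φ i) < 1 then bottleWeight i₀ p q i else 0 := by
  set c := bottleWeight i₀ p q with hc
  have hq : 0 < q := hp.trans_le hpq
  have hcpos : ∀ i, 0 < c i := fun i => by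
    simp only [hc, bottleWeight]
    split_ifs <;> assumption
  have hT := hw.1.1.tile φ hφ.ne'
  set J : Finset ι := univ.filter fun i => ¬ K.Adj x (φ i) with hJ
  have hN : (∑ i, if K.Adj x (φ i) then c i else 0) = (∑ i, c i) - ∑ i ∈ J, c i := by
    rw [hJ, ← sum_filter, eq_sub_iff_add_eq, sum_filter_add_sum_filter_not]
  have hF0 : ∀ i, 0 ≤ if load c w (φ i) < 1 then c i else 0 := fun i => by
    split_ifs <;> simp [(hcpos i).le]
  obtain ⟨j, hj⟩ : J.Nonempty := by
    rw [nonempty_iff_ne_empty]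
    intro he
    have hall : ∀ i, K.Adj x (φ i) := fun i => by
      by_contra h
      have : i ∈ J := by simp [hJ, h]
      simp [he] at this
    exact hw.1.not_forall_slack hT fun i =>
      hw.load_lt_of_update hcpos hφ hxS hx fun k _ => hall k
  rw [hN]
  by_cases h2 : ∃ k ∈ J, k ≠ j
  · obtain ⟨k, hk, hkj⟩ := h2
    have h1 : c j + c k ≤ ∑ i ∈ J, c i := by
      rw [← sum_pair hkj.symm]
      exact sum_le_sum_of_subset_of_nonneg (by simp [insert_subset_iff, hj, hk])
        fun i _ _ => (hcpos i).le
    have h3 : p + q ≤ c j + c k := by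
      simp only [hc, bottleWeight]
      split_ifs with h h'
      · exact (hkj (h'.trans h.symm)).elim
      all_goals linarith
    have h4 : 0 ≤ p / q * ∑ i, if load c w (φ i) < 1 then c i else 0 :=
      mul_nonneg (div_nonneg hp.le hq.le) (sum_nonneg fun i _ => hF0 i)
    constructor <;> linarith
  · push Not at h2
    have hJj : J = {j} := by
      ext k
      simp only [mem_singleton]
      exact ⟨h2 k, fun h => h ▸ hj⟩
    have hadj : ∀ i, i ≠ j → K.Adj x (φ i) := fun i hi => by
      by_contra h
      exact hi (h2 i (by simp [hJ, h]))
    have hslack := hw.load_lt_of_update hcpos hφ hxS hx hadj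
    have hcj : c j = q := by
      by_cases h : j = i₀
      · subst h
        -- A slack vertex cannot sit at the distinguished index when `p < q`; when `p = q` the index
        -- makes no difference.
        have : ¬ p < q := fun hlt => hw.load_distinguished hlt hφ hslack
        simp only [hc, bottleWeight, if_true]
        linarith
      · simp [hc, bottleWeight, h]
    have h5 : q ≤ ∑ i, if load c w (φ i) < 1 then c i else 0 := by
      have := single_le_sum (f := fun i => if load c w (φ i) < 1 then c i else 0)
        (fun i _ => hF0 i) (mem_univ j)
      simpa [hslack, hcj] using this
    have h6 : p ≤ p / q * ∑ i, if load c w (φ i) < 1 then c i else 0 := by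
      calc p = p / q * q := by field_simp
        _ ≤ _ := mul_le_mul_of_nonneg_left h5 (div_nonneg hp.le hq.le)
    rw [hJj, sum_singleton, hcj]
    constructor <;> linarith

lemma load_eq_zero (hw : IsFracTiling K c S w) {a : A} (ha : a ∉ S) : load c w a = 0 := by
  refine sum_eq_zero fun φ _ => ?_
  by_cases h : w φ = 0
  · simp [h]
  · have := (hw.tile φ h).1
    have h' : ∀ i, φ i ≠ a := fun i h => ha (h ▸ this i)
    simp [content, h']

lemma sum_load (hw : IsFracTiling K c S w) :
    ∑ a ∈ S, load c w a = (∑ i, c i) * ∑ φ, w φ := by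
  have h := sum_load_mul (c := c) w fun _ => 1
  simp only [mul_one] at h
  rw [sum_subset (subset_univ S) fun a _ ha => load_eq_zero hw ha, h, ← sum_mul, mul_comm]

-- Split each neighbour of `x` into its uncovered part, which sums to at most the defect, and its
-- load, which is averaged over tiles through `IsSaturated.mass_le`. The slack mass summed over all
-- tiles is at most the number of slack vertices.
open scoped Classical in
lemma IsSaturated.degIn_le {p q : ℝ} (hp : 0 < p) (hpq : p ≤ q) {i₀ : ι} (hι : p + q ≤ ∑ i, c i)
    (hcb : c = bottleWeight i₀ p q) (hw : IsSaturated K c S w) {x : A} (hxS : x ∈ S)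
    (hx : load c w x < 1) :
    (degIn K S x : ℝ) ≤ (#S - (∑ i, c i) * ∑ φ, w φ) +
      min ((1 - (p + q) / ∑ i, c i) * #S + p / q * #{a ∈ S | load c w a < 1})
        ((1 - q / ∑ i, c i) * #S) := by
  set M := ∑ i, c i with hM
  have hq : 0 < q := hp.trans_le hpq
  have hM0 : 0 < M := by linarith
  set W := ∑ φ, w φ with hW
  have hsum : ∑ a ∈ S, load c w a = M * W := sum_load hw.1.1
  have hW0 : 0 ≤ W := sum_nonneg fun φ _ => hw.1.1.nonneg φ
  have hMW : M * W ≤ #S := by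
    rw [← hsum]
    calc ∑ a ∈ S, load c w a ≤ ∑ a ∈ S, (1 : ℝ) := sum_le_sum fun a _ => hw.1.1.load_le a
      _ = #S := by simp
  have hdeg : (degIn K S x : ℝ) ≤ (#S - M * W) + ∑ a, load c w a * (if K.Adj x a then 1 else 0) := by
    have h1 : (degIn K S x : ℝ) = ∑ a ∈ S, if K.Adj x a then (1 : ℝ) else 0 := by
      simp [degIn]
    have h2 : ∑ a, load c w a * (if K.Adj x a then 1 else 0) =
        ∑ a ∈ S, load c w a * (if K.Adj x a then 1 else 0) := by
      rw [sum_subset (subset_univ S) fun a _ ha => by rw [load_eq_zero hw.1.1 ha, zero_mul]]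
    have h3 : (#S - M * W) = ∑ a ∈ S, (1 - load c w a) := by
      rw [sum_sub_distrib, hsum]; simp
    rw [h1, h2, h3, ← sum_add_distrib]
    refine sum_le_sum fun a _ => ?_
    have := hw.1.1.load_le a
    split_ifs <;> linarith
  rw [sum_load_mul] at hdeg
  have hF : ∑ φ, w φ * ∑ i, c i * (if load c w (φ i) < 1 then 1 else 0) ≤
      #{a ∈ S | load c w a < 1} := by
    rw [← sum_load_mul w fun a => if load c w a < 1 then (1 : ℝ) else 0, ← sum_subset (subset_univ S) fun a _ ha => by
      rw [load_eq_zero hw.1.1 ha, zero_mul], card_filter, Nat.cast_sum]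
    refine sum_le_sum fun a _ => ?_
    have := hw.1.1.load_le a
    split_ifs <;> simp [this]
  have hmass : ∀ φ, w φ * ∑ i, c i * (if K.Adj x (φ i) then 1 else 0) ≤ w φ * (M - q) ∧
      w φ * ∑ i, c i * (if K.Adj x (φ i) then 1 else 0) ≤ w φ * (M - p - q) +
        p / q * (w φ * ∑ i, c i * (if load c w (φ i) < 1 then 1 else 0)) := by
    intro φ
    rcases (hw.1.1.nonneg φ).eq_or_lt with h | h
    · simp [← h]
    · subst hcb
      have := hw.mass_le hp hpq h hxS hx
      simp only [mul_ite, mul_one, mul_zero]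
      refine ⟨mul_le_mul_of_nonneg_left this.1 h.le, ?_⟩
      have h2 := mul_le_mul_of_nonneg_left this.2 h.le
      rw [mul_add, ← hM] at h2
      linarith
  have hfrac : ∀ t : ℝ, t ≤ M → t * W ≤ t / M * #S ∨ t < 0 := by
    intro t _
    rcases lt_or_ge t 0 with h | h
    · exact Or.inr h
    · left
      calc t * W = t / M * (M * W) := by field_simp
        _ ≤ _ := mul_le_mul_of_nonneg_left hMW (by positivity)
  rw [← sub_le_iff_le_add']
  rw [← sub_le_iff_le_add'] at hdeg
  refine hdeg.trans (le_min ?_ ?_)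
  · calc _ ≤ ∑ φ, (w φ * (M - p - q) +
          p / q * (w φ * ∑ i, c i * (if load c w (φ i) < 1 then 1 else 0))) :=
          sum_le_sum fun φ _ => (hmass φ).2
      _ = (M - p - q) * W +
          p / q * ∑ φ, (w φ * ∑ i, c i * (if load c w (φ i) < 1 then 1 else 0)) := by
          rw [sum_add_distrib, ← sum_mul, ← mul_sum]; ring
      _ ≤ (M - p - q) / M * #S + p / q * #{a ∈ S | load c w a < 1} := by
          refine add_le_add ?_ (mul_le_mul_of_nonneg_left hF (by positivity))
          exact (hfrac (M - p - q) (by linarith)).resolve_right (by linarith)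
      _ = _ := by field_simp; ring
  · calc _ ≤ ∑ φ, w φ * (M - q) := sum_le_sum fun φ _ => (hmass φ).1
      _ = (M - q) * W := by rw [← sum_mul]; ring
      _ ≤ (M - q) / M * #S := (hfrac (M - q) (by linarith)).resolve_right (by linarith)
      _ = _ := by field_simp

/-- Some fractional tiling leaves at most `u` of the total weight of `S` uncovered. -/
def HasDefect (K : SimpleGraph A) (c : ι → ℝ) (S : Finset A) (u : ℝ) : Prop :=
  ∃ w, IsFracTiling K c S w ∧ #S - (∑ i, c i) * ∑ φ, w φ ≤ u

lemma IsSaturated.defect_le (hc : 0 ≤ ∑ i, c i) (hw : IsSaturated K c S w) {u : ℝ}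
    (h : HasDefect K c S u) : #S - (∑ i, c i) * ∑ φ, w φ ≤ u := by
  obtain ⟨w', hw', hu⟩ := h
  linarith [mul_le_mul_of_nonneg_left (hw.1.2 w' hw') hc]

/-- A small defect can be removed altogether under the degree condition. -/
theorem hasDefect_zero [Nonempty ι] {p q u : ℝ} (hp : 0 < p) (hpq : p ≤ q) {i₀ : ι}
    (hι : p + q ≤ ∑ i, c i) (hcb : c = bottleWeight i₀ p q) (hu : HasDefect K c S u)
    (hdeg : ∀ F ⊆ S, F.Nonempty → ∃ x ∈ F, u + min ((1 - (p + q) / ∑ i, c i) * #S + p / q * #F)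
        ((1 - q / ∑ i, c i) * #S) < degIn K S x) :
    HasDefect K c S 0 := by
  classical
  have hq : 0 < q := hp.trans_le hpq
  have hcpos : ∀ i, 0 < c i := fun i => by
    simp only [hcb, bottleWeight]
    split_ifs <;> assumption
  obtain ⟨w, hw⟩ := exists_isSaturated (K := K) (S := S) hcpos
  have hwu := hw.defect_le (by linarith) hu
  refine ⟨w, hw.1.1, ?_⟩
  -- Without slack vertices all loads equal `1` and nothing is uncovered. Otherwise `hdeg`, applied
  -- to the slack set, contradicts `IsSaturated.degIn_le`.
  rcases (S.filter fun a => load c w a < 1).eq_empty_or_nonempty with he | hne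
  · rw [← sum_load hw.1.1]
    have : ∀ a ∈ S, load c w a = 1 := fun a ha => by
      rw [filter_eq_empty_iff] at he
      linarith [hw.1.1.load_le a, not_lt.1 (he ha)]
    rw [sum_congr rfl this]
    simp
  · obtain ⟨x, hxF, hx⟩ := hdeg _ (filter_subset _ _) hne
    rw [mem_filter] at hxF
    linarith [hw.degIn_le hp hpq hι hcb hxF.1 hxF.2]

end Bottle
end FracTiling

/-! ### Universal vertices, and degree conditions with an error term. -/

namespace FracTiling

section Universal

variable {A ι : Type*} [Fintype A] [DecidableEq A] [Fintype ι] [DecidableEq ι]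
  {K : SimpleGraph A} {c : ι → ℝ} {S : Finset A}

open scoped Classical in
/-- Deleting a vertex increases the defect by a bounded amount. -/
lemma HasDefect.of_insert {p u : ℝ} (hp : 0 < p) (hc : ∀ i, p ≤ c i) {x : A} (hx : x ∉ S)
    (h : HasDefect K c (insert x S) u) : HasDefect K c S (u + (∑ i, c i) / p) := by
  obtain ⟨w, hw, hu⟩ := h
  have hc0 : ∀ i, 0 ≤ c i := fun i => hp.le.trans (hc i)
  -- Discard every tile through `x`. Each puts at least `p` per unit of weight on `x`, whose load is
  -- at most `1`, so the total drops by at most `1 / p`.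
  set w' : (ι → A) → ℝ := fun φ => if ∃ i, φ i = x then 0 else w φ with hw'
  have hle : ∀ φ, w' φ ≤ w φ := fun φ => by
    simp only [hw']
    split_ifs
    exacts [hw.nonneg φ, le_rfl]
  have hsum : ∑ φ, w φ ≤ ∑ φ, w' φ + 1 / p := by
    have h1 : p * ∑ φ, (w φ - w' φ) ≤ load c w x := by
      rw [mul_sum]
      refine sum_le_sum fun φ _ => ?_
      by_cases h : ∃ i, φ i = x
      · obtain ⟨i, hi⟩ := h
        have h2 := (hc i).trans (le_content hc0 φ i)
        rw [hi] at h2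
        simp only [hw', show ∃ i, φ i = x from ⟨i, hi⟩, if_true, sub_zero]
        rw [mul_comm]
        exact mul_le_mul_of_nonneg_left h2 (hw.nonneg φ)
      · simp only [hw', h, if_false, sub_self, mul_zero]
        exact mul_nonneg (hw.nonneg φ) (content_nonneg hc0 φ x)
    have h2 : ∑ φ, (w φ - w' φ) ≤ 1 / p := by
      rw [le_div_iff₀ hp]
      linarith [hw.load_le x]
    rw [sum_sub_distrib] at h2
    linarith
  refine ⟨w', ⟨fun φ => ?_, fun φ h => ?_, fun a => ?_⟩, ?_⟩
  · simp only [hw']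
    split_ifs
    exacts [le_rfl, hw.nonneg φ]
  · have h1 : ¬ ∃ i, φ i = x := fun h' => h (by simp [hw', h'])
    have h2 : w φ ≠ 0 := by simpa [hw', h1] using h
    refine ⟨fun i => ?_, (hw.tile φ h2).2⟩
    exact (mem_insert.1 ((hw.tile φ h2).1 i)).resolve_left fun h => h1 ⟨i, h⟩
  · exact (sum_le_sum fun φ _ => mul_le_mul_of_nonneg_right (hle φ)
      (content_nonneg hc0 φ a)).trans (hw.load_le a)
  · rw [card_insert_of_notMem hx] at hu
    push_cast at hu
    have := mul_le_mul_of_nonneg_left hsum (sum_nonneg fun i (_ : i ∈ univ) => hc0 i)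
    rw [mul_add, mul_one_div] at this
    linarith

/-- The join of `R` with a complete graph on `T` vertices. -/
def withUniversal (R : SimpleGraph A) (T : ℕ) : SimpleGraph (A ⊕ Fin T) where
  Adj x y := x ≠ y ∧ ∀ a b, x = Sum.inl a → y = Sum.inl b → R.Adj a b
  symm := ⟨fun _ _ h => ⟨h.1.symm, fun a b ha hb => (h.2 b a hb ha).symm⟩⟩
  loopless := ⟨fun _ h => h.1 rfl⟩

/-- The vertices of `S` and the first `t` universal vertices. -/
def addUniversal (S : Finset A) (T t : ℕ) : Finset (A ⊕ Fin T) :=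
  S.disjSum (univ.filter fun i : Fin T => i.val < t)

lemma card_addUniversal {T t : ℕ} (h : t ≤ T) : #(addUniversal S T t) = #S + t := by
  rw [addUniversal, card_disjSum, Fin.card_filter_val_lt, min_eq_right h]

lemma addUniversal_succ {T t : ℕ} (h : t < T) :
    addUniversal S T (t + 1) = insert (Sum.inr ⟨t, h⟩) (addUniversal S T t) := by
  ext (a | i)
  · simp [addUniversal]
  · simp [addUniversal, Fin.ext_iff, le_iff_eq_or_lt]

lemma notMem_addUniversal {T t : ℕ} (h : t < T) : Sum.inr ⟨t, h⟩ ∉ addUniversal S T t := by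
  simp [addUniversal]

lemma degIn_inl (R : SimpleGraph A) {T t : ℕ} (h : t ≤ T) (a : A) :
    degIn (withUniversal R T) (addUniversal S T t) (Sum.inl a) = degIn R S a + t := by
  classical
  have : {b ∈ addUniversal S T t | (withUniversal R T).Adj (Sum.inl a) b} =
      addUniversal {b ∈ S | R.Adj a b} T t := by
    ext (b | i)
    · simp only [addUniversal, mem_filter, inl_mem_disjSum]
      refine and_congr_right fun _ => ⟨fun h => h.2 a b rfl rfl, fun h => ⟨?_, ?_⟩⟩
      · simpa using h.ne
      · rintro _ _ ⟨⟩ ⟨⟩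
        exact h
    · simp [addUniversal, withUniversal]
  rw [degIn, degIn, this, card_addUniversal h]

lemma degIn_inr (R : SimpleGraph A) {T t : ℕ} (h : t ≤ T) {i : Fin T} (hi : i.val < t) :
    degIn (withUniversal R T) (addUniversal S T t) (Sum.inr i) = #S + t - 1 := by
  classical
  have : {b ∈ addUniversal S T t | (withUniversal R T).Adj (Sum.inr i) b} =
      (addUniversal S T t).erase (Sum.inr i) := by
    ext b
    simp [withUniversal, and_comm, eq_comm]
  rw [degIn, this, card_erase_of_mem (by simpa [addUniversal]), card_addUniversal h]

lemma HasDefect.of_addUniversal {R : SimpleGraph A} {T : ℕ} {u : ℝ}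
    (h : HasDefect (withUniversal R T) c (addUniversal S T 0) u) : HasDefect R c S u := by
  obtain ⟨w, hw, hu⟩ := h
  have hinj : Function.Injective fun (φ : ι → A) (i : ι) => (Sum.inl (φ i) : A ⊕ Fin T) :=
    fun φ ψ h => funext fun i => Sum.inl_injective (congrFun h i)
  have hrange : ∀ φ : ι → A ⊕ Fin T,
      φ ∉ Set.range (fun (φ : ι → A) (i : ι) => (Sum.inl (φ i) : A ⊕ Fin T)) → w φ = 0 := by
    intro φ hφ
    by_contra h
    have h1 : ∀ i, ∃ a, φ i = Sum.inl a := fun i => by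
      have := (hw.tile φ h).1 i
      rcases hφi : φ i with a | k
      · exact ⟨a, rfl⟩
      · simp [hφi, addUniversal] at this
    choose f hf using h1
    exact hφ ⟨f, funext fun i => (hf i).symm⟩
  refine ⟨fun φ => w fun i => Sum.inl (φ i), ⟨fun φ => hw.nonneg _, fun φ h => ?_, fun a => ?_⟩, ?_⟩
  · have := hw.tile _ h
    exact ⟨fun i => by simpa [addUniversal] using this.1 i,
      fun i j hij => (this.2 i j hij).2 _ _ rfl rfl⟩
  · refine le_trans (le_of_eq ?_) (hw.load_le (Sum.inl a))
    unfold load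
    refine Fintype.sum_of_injective _ hinj _ _ (fun φ hφ => by rw [hrange φ hφ, zero_mul])
      fun φ => ?_
    simp [content]
  · have h1 : ∑ φ : ι → A, (w fun i => Sum.inl (φ i)) = ∑ φ, w φ :=
      Fintype.sum_of_injective _ hinj _ _ hrange fun φ => rfl
    rw [h1]
    rwa [card_addUniversal (Nat.zero_le _), add_zero] at hu

/-- With many universal vertices, most of the weight can be covered. -/
lemma hasDefect_addUniversal [Nonempty ι] (R : SimpleGraph A) (T : ℕ) (hc : ∀ i, 0 < c i) :
    HasDefect (withUniversal R T) c (addUniversal S T T) (#S + Fintype.card ι) := by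
  classical
  obtain ⟨w, hw⟩ := exists_isSaturated (K := withUniversal R T) (S := addUniversal S T T) hc
  refine ⟨w, hw.1.1, ?_⟩
  set F : Finset (Fin T) := univ.filter fun i => load c w (Sum.inr i) < 1 with hF
  -- Universal vertices are pairwise adjacent, so `|ι|` of them with slack would form a tile with
  -- slack throughout.
  have hFc : #F ≤ Fintype.card ι := by
    by_contra! h
    obtain ⟨f⟩ : Nonempty (ι ↪ F) :=
      Function.Embedding.nonempty_of_card_le (by simpa using h.le)
    refine hw.1.not_forall_slack (ψ := fun i => Sum.inr (f i).1) ⟨fun i => ?_, fun i j hij => ?_⟩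
      fun i => ?_
    · simp [addUniversal]
    · simpa [withUniversal, Subtype.ext_iff] using hij
    · exact (mem_filter.1 (f i).2).2
  have hc0 : ∀ i, 0 ≤ c i := fun i => (hc i).le
  rw [← sum_load hw.1.1]
  have h1 : (#(addUniversal S T T) : ℝ) - ∑ a ∈ addUniversal S T T, load c w a =
      ∑ a ∈ addUniversal S T T, (1 - load c w a) := by simp
  rw [h1, addUniversal, sum_disjSum]
  refine add_le_add ?_ ?_
  · calc ∑ a ∈ S, (1 - load c w (Sum.inl a)) ≤ ∑ a ∈ S, (1 : ℝ) :=
        sum_le_sum fun a _ => by linarith [load_nonneg hc0 hw.1.1.nonneg (Sum.inl a)]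
      _ = #S := by simp
  · calc ∑ i : Fin T with i.val < T, (1 - load c w (Sum.inr i)) ≤
          ∑ i : Fin T with i.val < T, if load c w (Sum.inr i) < 1 then (1 : ℝ) else 0 := by
          refine sum_le_sum fun i _ => ?_
          split_ifs with h
          · linarith [load_nonneg hc0 hw.1.1.nonneg (Sum.inr i)]
          · linarith
      _ = #F := by
          rw [hF, card_filter]
          simp
      _ ≤ _ := by exact_mod_cast hFc

/-- A bottle-type degree condition with error `g` yields a fractional tiling of defect `O(g)`. -/
theorem hasDefect_of_degIn [Nonempty ι] {p q g : ℝ} (hp : 0 < p) (hpq : p ≤ q) {i₀ : ι}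
    (hι : p + q ≤ ∑ i, c i) (hcb : c = bottleWeight i₀ p q) (hg : 0 ≤ g) {R : SimpleGraph A}
    (hdeg : ∀ F ⊆ S, F.Nonempty → ∃ x ∈ F, min ((1 - (p + q) / ∑ i, c i) * #S + p / q * #F)
        ((1 - q / ∑ i, c i) * #S) - g ≤ degIn R S x) :
    HasDefect R c S ((((∑ i, c i) / p + g + 1) * (∑ i, c i) / q + 2) * ((∑ i, c i) / p)) := by
  have hq : 0 < q := hp.trans_le hpq
  have hcp : ∀ i, p ≤ c i := fun i => by
    simp only [hcb, bottleWeight]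
    split_ifs <;> linarith
  have hcpos : ∀ i, 0 < c i := fun i => hp.trans_le (hcp i)
  set M := ∑ i, c i with hM
  have hM0 : 0 < M := by linarith
  have hqM : 0 < q / M := by positivity
  have hqM1 : q / M ≤ 1 := (div_le_one hM0).2 (by linarith)
  -- `T` is so large that its surplus `T * (q / M)` exceeds the initial defect `#S + |ι|` plus `g +
  -- 1`; `t₀` is the number of universal vertices for which the surplus still exceeds the defect `M
  -- / p` of one deletion plus `g + 1`.
  set T : ℕ := ⌈(#S + Fintype.card ι + M / p + g + 1) * M / q⌉₊ + 1 with hT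
  set t₀ : ℕ := ⌈(M / p + g + 1) * M / q⌉₊ + 1 with ht₀
  have ht₀T : t₀ ≤ T := by
    rw [hT, ht₀]
    gcongr
    linarith [show (0 : ℝ) ≤ #S + Fintype.card ι by positivity]
  -- The surplus `t * (q / M)` beats the defect `u`, the error `g`, and the `1` lost because a
  -- universal vertex is not its own neighbour.
  have hzero : ∀ (t : ℕ) (u : ℝ), t ≤ T → 0 ≤ u → u + g + 1 < t * (q / M) →
      HasDefect (withUniversal R T) c (addUniversal S T t) u →
      HasDefect (withUniversal R T) c (addUniversal S T t) 0 := by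
    intro t u htT hu0 hut hu
    have ht1 : 1 ≤ t := by
      by_contra! h
      have : t = 0 := by lia
      subst this
      simp at hut
      linarith
    refine hasDefect_zero hp hpq hι hcb hu fun F hF hne => ?_
    rw [card_addUniversal htT]
    by_cases hex : ∃ i, Sum.inr i ∈ F
    · obtain ⟨i, hi⟩ := hex
      refine ⟨_, hi, ?_⟩
      have hit : i.val < t := by simpa [addUniversal] using hF hi
      rw [degIn_inr R htT hit, Nat.cast_sub (by lia)]
      refine (add_le_add_right (min_le_right _ _) u).trans_lt ?_
      push_cast
      have : 0 ≤ (#S : ℝ) * (q / M) := by positivity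
      nlinarith
    · push Not at hex
      have hFl : F = F.toLeft.map Function.Embedding.inl := by
        ext (a | i)
        · simp
        · simp [hex i]
      have hFS : F.toLeft ⊆ S := fun a ha => by
        simpa [addUniversal] using hF (mem_toLeft.1 ha)
      have hFne : F.toLeft.Nonempty := by
        rw [hFl] at hne
        simpa using hne
      obtain ⟨x, hx, hdx⟩ := hdeg _ hFS hFne
      refine ⟨Sum.inl x, mem_toLeft.1 hx, ?_⟩
      have hcard : #F = #F.toLeft := by
        conv_lhs => rw [hFl]
        simp
      rw [degIn_inl R htT, hcard]
      push_cast
      have hpM : 0 < p / M := by positivity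
      have hsplit : (p + q) / M = p / M + q / M := add_div _ _ _
      have hmin : min ((1 - (p + q) / M) * (#S + t : ℝ) + p / q * #F.toLeft)
          ((1 - q / M) * (#S + t : ℝ)) ≤ min ((1 - (p + q) / M) * #S + p / q * #F.toLeft)
          ((1 - q / M) * #S) + (t - t * (q / M)) := by
        rw [← min_add_add_right]
        refine min_le_min ?_ (le_of_eq (by ring))
        rw [hsplit]
        have : 0 ≤ (t : ℝ) * (p / M) := by positivity
        nlinarith
      linarith
  have hlarge : ∀ (t : ℕ) (a : ℝ), 0 ≤ a → ⌈a * M / q⌉₊ + 1 ≤ t → a < t * (q / M) := by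
    intro t a ha ht
    have h1 : a * M / q < t := (Nat.le_ceil _).trans_lt (by exact_mod_cast ht)
    calc a = a * M / q * (q / M) := by field_simp
      _ < _ := by gcongr
  have hMp : 0 ≤ M / p := by positivity
  -- Downwards from `T`: delete a universal vertex, then heal the resulting defect `M / p`.
  have hall : ∀ t, t₀ ≤ t → t ≤ T → HasDefect (withUniversal R T) c (addUniversal S T t) 0 := by
    intro t ht htT
    induction htT using Nat.decreasingInduction with
    | self =>
      refine hzero T _ le_rfl (by positivity) ?_ (hasDefect_addUniversal R T hcpos)
      refine lt_of_le_of_lt ?_ (hlarge T (#S + Fintype.card ι + M / p + g + 1) (by positivity)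
        hT.ge)
      linarith
    | of_succ t htT ih =>
      have h1 := ih (by lia)
      rw [addUniversal_succ htT] at h1
      have h2 := h1.of_insert hp hcp (notMem_addUniversal htT)
      rw [zero_add] at h2
      exact hzero t _ (by lia) hMp (hlarge t _ (by positivity) ht) h2
  -- Below `t₀` deletions are no longer repaired, and each adds `M / p` to the defect.
  have hstrip : ∀ t, t ≤ T → ∀ u : ℝ, HasDefect (withUniversal R T) c (addUniversal S T t) u →
      HasDefect (withUniversal R T) c (addUniversal S T 0) (u + t * (M / p)) := by
    intro t
    induction t with
    | zero => intro _ u h; simpa using h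
    | succ t ih =>
      intro ht u h
      rw [addUniversal_succ ht] at h
      have := ih (by lia) _ (h.of_insert hp hcp (notMem_addUniversal ht))
      convert this using 1
      push_cast
      ring
  obtain ⟨w, hw, hu⟩ := (hstrip t₀ ht₀T 0 (hall t₀ le_rfl ht₀T)).of_addUniversal
  refine ⟨w, hw, hu.trans ?_⟩
  rw [zero_add]
  refine mul_le_mul_of_nonneg_right ?_ hMp
  rw [ht₀]
  push_cast
  linarith [Nat.ceil_lt_add_one (show 0 ≤ (M / p + g + 1) * M / q by positivity)]

end Universal
end FracTiling

/-! ### Regular pairs and greedy embedding. -/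

namespace SimpleGraph

section Regular

variable {V : Type*} [Fintype V] [DecidableEq V] {G : SimpleGraph V} [DecidableRel G.Adj]

lemma card_interedges_eq_sum (s t : Finset V) :
    #(G.interedges s t) = ∑ a ∈ s, #{b ∈ t | G.Adj a b} := by
  simp only [interedges, Rel.interedges, card_filter, sum_product]

/-- In a regular pair, few vertices have low degree into a large subset of the other side. -/
lemma IsUniform.card_lowDegree_lt {ε d : ℝ} {s t A B : Finset V} (h : G.IsUniform ε s t)
    (hd : d ≤ G.edgeDensity s t) (hA : A ⊆ s) (hB : B ⊆ t) (hBt : #t * ε ≤ #B)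
    (hs : s.Nonempty) :
    (#{v ∈ A | (#{b ∈ B | G.Adj v b} : ℝ) < (d - ε) * #B} : ℝ) < #s * ε := by
  by_contra! hcon
  set D := {v ∈ A | (#{b ∈ B | G.Adj v b} : ℝ) < (d - ε) * #B} with hD
  have hs0 : (0 : ℝ) < #s := by exact_mod_cast hs.card_pos
  have hD0 : (0 : ℝ) < #D := (mul_pos hs0 h.pos).trans_le hcon
  have hDne : D.Nonempty := by
    rw [← card_pos]; exact_mod_cast hD0
  have h1 := h ((filter_subset _ _).trans hA) hB hcon hBt
  have h2 : d - ε < (G.edgeDensity D B : ℝ) := by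
    have := (abs_lt.1 h1).1
    linarith
  have h3 : (#(G.interedges D B) : ℝ) < #D * ((d - ε) * #B) := by
    rw [card_interedges_eq_sum, Nat.cast_sum, ← nsmul_eq_mul, ← sum_const]
    exact sum_lt_sum_of_nonempty hDne fun v hv => (mem_filter.1 hv).2
  rcases (Nat.cast_nonneg (α := ℝ) #B).eq_or_lt with hB0 | hB0
  · rw [← hB0] at h3
    simp only [mul_zero] at h3
    exact absurd h3 (not_lt.2 (Nat.cast_nonneg _))
  · rw [edgeDensity_def] at h2
    push_cast at h2
    rw [lt_div_iff₀ (mul_pos hD0 hB0)] at h2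
    nlinarith

/-- In a sparse regular pair, few vertices have high degree into the other side. -/
lemma IsUniform.card_highDegree_lt {ε d : ℝ} {s t : Finset V} (h : G.IsUniform ε s t)
    (hd : (G.edgeDensity s t : ℝ) < d) (hε : ε ≤ 1) (hs : s.Nonempty) :
    (#{v ∈ s | (d + ε) * #t < (#{b ∈ t | G.Adj v b} : ℝ)} : ℝ) < #s * ε := by
  by_contra! hcon
  set D := {v ∈ s | (d + ε) * #t < (#{b ∈ t | G.Adj v b} : ℝ)} with hD
  have hs0 : (0 : ℝ) < #s := by exact_mod_cast hs.card_pos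
  have hD0 : (0 : ℝ) < #D := (mul_pos hs0 h.pos).trans_le hcon
  have hDne : D.Nonempty := by
    rw [← card_pos]; exact_mod_cast hD0
  have h1 := h (filter_subset _ _) subset_rfl hcon
    (mul_le_of_le_one_right (Nat.cast_nonneg _) hε)
  have h2 : (G.edgeDensity D t : ℝ) < d + ε := by
    have := (abs_lt.1 h1).2
    linarith
  have h3 : #D * ((d + ε) * #t) < (#(G.interedges D t) : ℝ) := by
    rw [card_interedges_eq_sum, Nat.cast_sum, ← nsmul_eq_mul, ← sum_const]
    exact sum_lt_sum_of_nonempty hDne fun v hv => (mem_filter.1 hv).2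
  rcases (Nat.cast_nonneg (α := ℝ) #t).eq_or_lt with ht0 | ht0
  · have ht : t = ∅ := by
      rw [← card_eq_zero]; exact_mod_cast ht0.symm
    subst ht
    simp [interedges, Rel.interedges] at h3
  · rw [edgeDensity_def] at h2
    push_cast at h2
    rw [div_lt_iff₀ (mul_pos hD0 ht0)] at h2
    nlinarith

variable {ι X : Type*} [Fintype ι] [DecidableEq ι] [DecidableEq X]

/-- A complete multipartite graph embeds into large subsets of pairwise regular dense clusters. -/
theorem exists_embedding_of_isUniform {ε d γ : ℝ} (hγ0 : 0 < γ) (hγ : γ ≤ 1 / 2)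
    (hγd : γ ≤ d - ε) {C : ι → Finset V}
    (hC : ∀ i j, i ≠ j → G.IsUniform ε (C i) (C j) ∧ d ≤ G.edgeDensity (C i) (C j))
    (hne : ∀ i, (C i).Nonempty) (hε : 0 < ε)
    (l : X → ι) (s : Finset X) :
    ∀ (A : ι → Finset V) (θ : ℝ), 0 ≤ θ → (∀ i, A i ⊆ C i) →
      ε * (Fintype.card ι + 1) ≤ θ * γ ^ #s → (∀ i, 2 ≤ θ * γ ^ #s * #(C i)) →
      (∀ i, θ * #(C i) ≤ #(A i)) → ∃ f : X → V, Set.InjOn f s ∧ (∀ x ∈ s, f x ∈ A (l x)) ∧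
        ∀ x ∈ s, ∀ y ∈ s, l x ≠ l y → G.Adj (f x) (f y) := by
  induction s using Finset.induction_on with
  | empty =>
    intro A θ _ hA _ h2 hAc
    by_cases h : Nonempty X
    · obtain ⟨x⟩ := h
      obtain ⟨v, -⟩ := hne (l x)
      exact ⟨fun _ => v, by simp⟩
    · rw [not_nonempty_iff] at h
      exact ⟨h.elim, by simp⟩
  | insert x s hx ih =>
    intro A θ hθ hA hε2 h2 hAc
    rw [card_insert_of_notMem hx] at hε2 h2
    have hγ1 : γ ^ (#s + 1) ≤ 1 := pow_le_one₀ hγ0.le (by linarith)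
    have hθγ : θ * γ ^ (#s + 1) ≤ θ := mul_le_of_le_one_right hθ hγ1
    have hεθ : ε * (Fintype.card ι + 1) ≤ θ := hε2.trans hθγ
    have hε' : ∀ i, #(C i) * ε ≤ #(A i) := fun i => by
      refine le_trans ?_ (hAc i)
      rw [mul_comm]
      refine mul_le_mul_of_nonneg_right (le_trans ?_ hεθ) (Nat.cast_nonneg _)
      exact le_mul_of_one_le_right hε.le (by linarith [Nat.cast_nonneg (α := ℝ) (Fintype.card ι)])
    have hA2 : ∀ i, (2 : ℝ) ≤ #(A i) := fun i => (h2 i).trans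
      ((mul_le_mul_of_nonneg_right hθγ (Nat.cast_nonneg _)).trans (hAc i))
    set i₀ := l x with hi₀
    let bad : ι → Finset V := fun i =>
      {v ∈ A i₀ | (#{b ∈ A i | G.Adj v b} : ℝ) < (d - ε) * #(A i)}
    -- By regularity each other index rules out at most `ε * #(C i₀)` candidates for the image of
    -- `x`, fewer than `#(A i₀)` in all.
    have hbad : (#((univ.erase i₀).biUnion bad) : ℝ) < #(A i₀) := by
      have hC0 : (0 : ℝ) < #(C i₀) := by exact_mod_cast (hne i₀).card_pos
      calc (#((univ.erase i₀).biUnion bad) : ℝ) ≤ ∑ i ∈ univ.erase i₀, (#(bad i) : ℝ) := by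
            exact_mod_cast card_biUnion_le
        _ ≤ ∑ i ∈ univ.erase i₀, (#(C i₀) * ε : ℝ) := by
            refine sum_le_sum fun i hi => ?_
            have hi' := (hC i₀ i (ne_of_mem_erase hi).symm)
            exact (hi'.1.card_lowDegree_lt hi'.2 (hA i₀) (hA i) (hε' i) (hne i₀)).le
        _ ≤ ∑ i : ι, (#(C i₀) * ε : ℝ) :=
            sum_le_sum_of_subset_of_nonneg (erase_subset _ _) fun _ _ _ => by positivity
        _ = Fintype.card ι * (#(C i₀) * ε) := by simp
        _ < ε * (Fintype.card ι + 1) * #(C i₀) := by nlinarith [mul_pos hε hC0]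
        _ ≤ θ * #(C i₀) := mul_le_mul_of_nonneg_right hεθ hC0.le
        _ ≤ _ := hAc i₀
    obtain ⟨v, hvA, hvb⟩ := exists_mem_notMem_of_card_lt_card (by exact_mod_cast hbad)
    have hv : ∀ i, i ≠ i₀ → (d - ε) * #(A i) ≤ #{b ∈ A i | G.Adj v b} := fun i hi => by
      by_contra! hcon
      exact hvb (mem_biUnion.2 ⟨i, by simp [hi], mem_filter.2 ⟨hvA, hcon⟩⟩)
    -- Other candidate sets shrink to the neighbourhood of `v`; the one containing `v` loses only
    -- `v`. All retain a proportion `γ`, so `θ` becomes `θ * γ`.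
    let A' : ι → Finset V := fun i => if i = i₀ then (A i).erase v else {b ∈ A i | G.Adj v b}
    have hA'A : ∀ i, A' i ⊆ A i := fun i => by
      simp only [A']
      split_ifs
      exacts [erase_subset _ _, filter_subset _ _]
    have hA'c : ∀ i, θ * γ * #(C i) ≤ #(A' i) := fun i => by
      have h3 : θ * γ * #(C i) ≤ γ * #(A i) := by
        have := mul_le_mul_of_nonneg_left (hAc i) hγ0.le
        linarith
      refine h3.trans ?_
      simp only [A']
      split_ifs with h
      · subst h
        -- Since `#(A i₀) ≥ 2`, losing one element leaves at least half, and `γ ≤ 1 / 2`.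
        rw [card_erase_of_mem hvA, Nat.cast_sub (card_pos.2 ⟨v, hvA⟩)]
        have := hA2 i₀
        push_cast
        nlinarith
      · exact (mul_le_mul_of_nonneg_right hγd (Nat.cast_nonneg _)).trans (hv i h)
    have hpow : θ * γ * γ ^ #s = θ * γ ^ (#s + 1) := by ring
    obtain ⟨f, hf1, hf2, hf3⟩ := ih A' (θ * γ) (by positivity) (fun i => (hA'A i).trans (hA i))
      (by rwa [hpow]) (by rwa [hpow]) hA'c
    have hfv : ∀ y ∈ s, f y ≠ v ∧ (l y ≠ i₀ → G.Adj v (f y)) := fun y hy => by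
      have := hf2 y hy
      simp only [A'] at this
      split_ifs at this with h
      · exact ⟨(mem_erase.1 this).1, fun h' => (h' h).elim⟩
      · have := (mem_filter.1 this).2
        exact ⟨this.ne', fun _ => this⟩
    have hsx : ∀ y ∈ s, y ≠ x := fun y hy h => hx (h ▸ hy)
    refine ⟨Function.update f x v, ?_, ?_, ?_⟩
    · intro y hy z hz hyz
      rw [coe_insert, Set.mem_insert_iff] at hy hz
      rcases hy with rfl | hy <;> rcases hz with rfl | hz
      · rfl
      · rw [Function.update_self, Function.update_of_ne (hsx z hz)] at hyz
        exact ((hfv z hz).1 hyz.symm).elim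
      · rw [Function.update_self, Function.update_of_ne (hsx y hy)] at hyz
        exact ((hfv y hy).1 hyz).elim
      · rw [Function.update_of_ne (hsx z hz), Function.update_of_ne (hsx y hy)] at hyz
        exact hf1 hy hz hyz
    · intro y hy
      rcases mem_insert.1 hy with rfl | hy
      · rwa [Function.update_self]
      · rw [Function.update_of_ne (hsx y hy)]
        exact hA'A _ (hf2 y hy)
    · intro y hy z hz hyz
      rcases mem_insert.1 hy with rfl | hy' <;> rcases mem_insert.1 hz with rfl | hz'
      · exact (hyz rfl).elim
      · rw [Function.update_self, Function.update_of_ne (hsx z hz')]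
        exact (hfv z hz').2 hyz.symm
      · rw [Function.update_self, Function.update_of_ne (hsx y hy')]
        exact ((hfv y hy').2 hyz).symm
      · rw [Function.update_of_ne (hsx z hz'), Function.update_of_ne (hsx y hy')]
        exact hf3 y hy' z hz' hyz

end Regular

end SimpleGraph

/-! ### From fractional tilings of clusters to tilings by copies of `H`. -/

namespace SimpleGraph
open FracTiling

section Integer

variable {V I W κ ι : Type*} [Fintype V] [DecidableEq V] {G : SimpleGraph V}
  [Fintype I] [DecidableEq I] [Fintype W] [DecidableEq W] [Fintype κ] [DecidableEq κ] [Fintype ι]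
  [DecidableEq ι]

/-- A packing of copies of `H` which follows a given multiset of cluster tuples. -/
theorem exists_isTiling_of_multiset {H : SimpleGraph W} {l : W × κ → ι}
    (hl : ∀ u v k, H.Adj u v → l (u, k) ≠ l (v, k)) {C : I → Finset V} {β : ℝ}
    {P : (ι → I) → Prop}
    (hP : ∀ φ, P φ → ∀ A : ι → Finset V, (∀ i, A i ⊆ C (φ i)) →
      (∀ i, β * #(C (φ i)) ≤ #(A i)) → ∃ f : W × κ → V, Function.Injective f ∧
        (∀ x, f x ∈ A (l x)) ∧ ∀ x y, l x ≠ l y → G.Adj (f x) (f y))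
    (hdisj : Pairwise fun a b => Disjoint (C a) (C b)) {c : ι → ℝ}
    (hc : ∀ i, c i = #{x | l x = i}) (L : Multiset (ι → I)) (hL : ∀ φ ∈ L, P φ)
    (hload : ∀ a, (L.map fun φ => content c φ a).sum ≤ (1 - β) * #(C a)) :
    ∃ (T : Set G.Subgraph) (U : Finset V), IsTiling H G T ∧ coveredVerts T = U ∧
      (#U : ℝ) = L.card * ∑ i, c i ∧
      ∀ a, (#(U ∩ C a) : ℝ) ≤ (L.map fun φ => content c φ a).sum := by
  classical
  have hc0 : ∀ i, 0 ≤ c i := fun i => by rw [hc]; positivity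
  induction L using Multiset.induction with
  | empty =>
    exact ⟨∅, ∅, ⟨by simp, by simp⟩, by simp [coveredVerts], by simp, by simp⟩
  | cons φ L ih =>
    simp only [Multiset.map_cons, Multiset.sum_cons] at hload
    obtain ⟨T, U, hT, hTU, hU, hUC⟩ := ih (fun ψ hψ => hL ψ (Multiset.mem_cons_of_mem hψ))
      fun a => by linarith [hload a, content_nonneg hc0 φ a]
    -- Vertices used so far fill at most a proportion `1 - β` of each cluster, so the unused parts
    -- are large enough for `hP`. Each application embeds `|κ|` copies of `H` at once.
    obtain ⟨f, hf, hfA, hfG⟩ := hP φ (hL φ (Multiset.mem_cons_self φ L))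
      (fun i => C (φ i) \ U) (fun i => sdiff_subset) fun i => by
        have h1 : (#(C (φ i) \ U) : ℝ) = #(C (φ i)) - #(U ∩ C (φ i)) := by
          rw [eq_sub_iff_add_eq, inter_comm]
          exact_mod_cast card_sdiff_add_card_inter (C (φ i)) U
        rw [h1]
        linarith [hload (φ i), hUC (φ i), content_nonneg hc0 φ (φ i)]
    let cp : κ → Copy H G := fun k =>
      ⟨⟨fun u => f (u, k), fun {u v} huv => hfG _ _ (hl u v k huv)⟩,
        fun u v huv => (Prod.ext_iff.1 (hf huv)).1⟩
    have hverts : ∀ k, (cp k).toSubgraph.verts = Set.range fun u => f (u, k) := fun k => by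
      simp [Copy.toSubgraph, cp]
    have hfU : ∀ x, f x ∉ U := fun x => (mem_sdiff.1 (hfA x)).2
    have hnew : ∀ B ∈ T, ∀ k, Disjoint B.verts (cp k).toSubgraph.verts := fun B hB k => by
      rw [Set.disjoint_left, hverts]
      rintro _ hx ⟨u, rfl⟩
      refine hfU (u, k) ?_
      rw [← mem_coe, ← hTU]
      exact Set.mem_biUnion hB hx
    refine ⟨T ∪ Set.range fun k => (cp k).toSubgraph, U ∪ univ.image f, ⟨?_, ?_⟩, ?_, ?_, ?_⟩
    · rintro B (hB | ⟨k, rfl⟩)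
      · exact hT.copy B hB
      · exact ⟨(cp k).isoToSubgraph⟩
    · rintro B (hB | ⟨k, rfl⟩) B' (hB' | ⟨k', rfl⟩) hne
      · exact hT.disjoint hB hB' hne
      · exact hnew B hB k'
      · exact (hnew B' hB' k).symm
      · have hk : k ≠ k' := fun h => hne (by rw [h])
        simp only [Function.onFun, hverts]
        rw [Set.disjoint_left]
        rintro _ ⟨u, rfl⟩ ⟨v, hv⟩
        exact hk (Prod.ext_iff.1 (hf hv)).2.symm
    · have : coveredVerts (T ∪ Set.range fun k => (cp k).toSubgraph) =
          coveredVerts T ∪ ⋃ k, (cp k).toSubgraph.verts := by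
        simp only [coveredVerts, Set.biUnion_union, Set.biUnion_range]
      rw [this, hTU]
      simp only [hverts]
      ext v
      simp
      grind
    · rw [card_union_of_disjoint, card_image_of_injective _ hf, Nat.cast_add, hU,
        Multiset.card_cons]
      · have : ∑ i, c i = #(univ : Finset (W × κ)) := by
          simp only [hc]
          exact_mod_cast (card_eq_sum_card_fiberwise (f := l) (t := univ) (by simp)).symm
        rw [← this]
        push_cast
        ring
      · rw [Finset.disjoint_left]
        intro v hv hv'
        obtain ⟨x, -, rfl⟩ := mem_image.1 hv'
        exact hfU x hv
    · intro a
      rw [Multiset.map_cons, Multiset.sum_cons, union_inter_distrib_right]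
      have h1 : (#(univ.image f ∩ C a) : ℝ) ≤ content c φ a := by
        have hsub : univ.image f ∩ C a ⊆
            ({i | φ i = a} : Finset ι).biUnion fun i => ({x | l x = i} : Finset _).image f := by
          intro v hv
          obtain ⟨hv1, hv2⟩ := mem_inter.1 hv
          obtain ⟨x, -, rfl⟩ := mem_image.1 hv1
          have hx : f x ∈ C (φ (l x)) := (mem_sdiff.1 (hfA x)).1
          have hxa : φ (l x) = a := by
            by_contra h
            exact Finset.disjoint_left.1 (hdisj h) hx hv2
          refine mem_biUnion.2 ⟨l x, by simp [hxa], mem_image.2 ⟨x, by simp, rfl⟩⟩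
        have h2 := (card_le_card hsub).trans card_biUnion_le
        rw [sum_filter] at h2
        calc (#(univ.image f ∩ C a) : ℝ) ≤ ∑ i, if φ i = a then
              (#(({x | l x = i} : Finset _).image f) : ℝ) else 0 := by exact_mod_cast h2
          _ ≤ _ := by
            refine sum_le_sum fun i _ => ?_
            split_ifs
            · rw [hc]
              exact_mod_cast card_image_le
            · exact le_rfl
      have h3 : (#(U ∩ C a ∪ univ.image f ∩ C a) : ℝ) ≤ #(U ∩ C a) + #(univ.image f ∩ C a) := by
        exact_mod_cast card_union_le _ _
      linarith [hUC a]

/-- Rounding a fractional tiling of clusters gives a tiling by copies of `H`. -/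
theorem exists_isTiling_of_isFracTiling {H : SimpleGraph W} {l : W × κ → ι}
    (hl : ∀ u v k, H.Adj u v → l (u, k) ≠ l (v, k)) {C : I → Finset V} {β m : ℝ}
    (hm0 : 0 ≤ m) (hβ : β ≤ 1) {R : SimpleGraph I} {S : Finset I} (hm : ∀ a, m ≤ #(C a))
    (hP : ∀ φ : ι → I, IsTile R S φ → ∀ A : ι → Finset V, (∀ i, A i ⊆ C (φ i)) →
      (∀ i, β * #(C (φ i)) ≤ #(A i)) → ∃ f : W × κ → V, Function.Injective f ∧
        (∀ x, f x ∈ A (l x)) ∧ ∀ x y, l x ≠ l y → G.Adj (f x) (f y))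
    (hdisj : Pairwise fun a b => Disjoint (C a) (C b)) {c : ι → ℝ}
    (hc : ∀ i, c i = #{x | l x = i}) {w : (ι → I) → ℝ} (hw : IsFracTiling R c S w) :
    ∃ (T : Set G.Subgraph) (U : Finset V), IsTiling H G T ∧ coveredVerts T = U ∧
      ((1 - β) * m * ∑ φ, w φ - Fintype.card (ι → I)) * ∑ i, c i ≤ #U := by
  have hc0 : ∀ i, 0 ≤ c i := fun i => by rw [hc]; positivity
  have hβm : 0 ≤ (1 - β) * m := mul_nonneg (by linarith) hm0
  -- Rounding down loses less than one use of each map `φ`, whence the error `Fintype.card (ι → I)`.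
  set N : (ι → I) → ℕ := fun φ => ⌊(1 - β) * m * w φ⌋₊ with hN
  have hN1 : ∀ φ, (N φ : ℝ) ≤ (1 - β) * m * w φ := fun φ =>
    Nat.floor_le (mul_nonneg hβm (hw.nonneg φ))
  set L : Multiset (ι → I) := ∑ φ, N φ • {φ} with hL
  have hcard : L.card = ∑ φ, N φ := by
    simp [hL]
  have hsum : ∀ g : (ι → I) → ℝ, (L.map g).sum = ∑ φ, N φ * g φ := fun g => by
    have : (L.map g).sum = (Multiset.sumAddMonoidHom.comp (Multiset.mapAddMonoidHom g)) L := rfl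
    rw [this, hL, map_sum]
    simp [Multiset.map_nsmul, Multiset.sum_nsmul]
  have hmem : ∀ φ ∈ L, IsTile R S φ := fun φ hφ => by
    refine hw.tile φ fun h0 => ?_
    rw [hL, Multiset.mem_sum] at hφ
    obtain ⟨ψ, -, hψ⟩ := hφ
    obtain ⟨h1, h2⟩ := Multiset.mem_nsmul.1 hψ
    rw [Multiset.mem_singleton] at h2
    subst h2
    simp [hN, h0] at h1
  obtain ⟨T, U, hT, hTU, hU, -⟩ := exists_isTiling_of_multiset hl hP hdisj hc L hmem fun a => by
    rw [hsum]
    calc ∑ φ, N φ * content c φ a ≤ ∑ φ, (1 - β) * m * w φ * content c φ a :=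
          sum_le_sum fun φ _ => mul_le_mul_of_nonneg_right (hN1 φ) (content_nonneg hc0 φ a)
      _ = (1 - β) * m * load c w a := by simp only [load, mul_sum, mul_assoc]
      _ ≤ (1 - β) * m * 1 := mul_le_mul_of_nonneg_left (hw.load_le a) hβm
      _ ≤ _ := by
        rw [mul_one]
        exact mul_le_mul_of_nonneg_left (hm a) (by linarith)
  refine ⟨T, U, hT, hTU, ?_⟩
  rw [hU, hcard]
  refine mul_le_mul_of_nonneg_right ?_ (sum_nonneg fun i _ => hc0 i)
  have h1 : ∑ φ, ((1 - β) * m * w φ - 1) ≤ ∑ φ, (N φ : ℝ) :=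
    sum_le_sum fun φ _ => (Nat.sub_one_lt_floor _).le
  rw [sum_sub_distrib, ← mul_sum] at h1
  push_cast
  simpa using h1

end Integer

end SimpleGraph

/-! ### Degree sequences and the reduced graph. -/

namespace SimpleGraph
open FracTiling

lemma IsDegreeSequence.card_filter_lt {V : Type*} [Fintype V] {G : SimpleGraph V}
    [DecidableRel G.Adj] {d : ℕ → ℕ} (hd : G.IsDegreeSequence d) (t : ℝ) :
    #{i ∈ Icc 1 (Fintype.card V) | (d i : ℝ) < t} = #{v | (G.degree v : ℝ) < t} := by
  classical
  have h := congrArg (Multiset.countP fun m : ℕ => (m : ℝ) < t) hd.2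
  rw [Multiset.countP_map, Multiset.countP_map] at h
  exact h

/-- The degree sequence condition, restated for sets of vertices. -/
lemma IsDegreeSequence.exists_le_degree {V : Type*} [Fintype V] {G : SimpleGraph V}
    [DecidableRel G.Adj] {d : ℕ → ℕ} (hd : G.IsDegreeSequence d) {p q M : ℝ} (hp : 0 < p)
    (hpq : p ≤ q) (hM : q ≤ M) (hn : M / q ≤ Fintype.card V)
    (h : ∀ i : ℕ, 1 ≤ i → (i : ℝ) ≤ q / M * Fintype.card V →
      (1 - (p + q) / M) * Fintype.card V + p / q * i ≤ d i) {X : Finset V} (hX : X.Nonempty) :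
    ∃ x ∈ X, min ((1 - (p + q) / M) * Fintype.card V + p / q * #X)
      ((1 - q / M) * Fintype.card V) - 1 ≤ G.degree x := by
  by_contra! hcon
  set n := Fintype.card V with hn'
  set t := min ((1 - (p + q) / M) * n + p / q * #X) ((1 - q / M) * n) - 1 with ht
  have hq : 0 < q := hp.trans_le hpq
  have hM0 : 0 < M := hq.trans_le hM
  have hpq1 : p / q ≤ 1 := (div_le_one hq).2 hpq
  have hpq0 : 0 < p / q := by positivity
  -- The largest index permitted both by `#X` and by the range of the hypothesis. In the second case
  -- rounding costs at most `p / q ≤ 1`, which is the `- 1` in the conclusion.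
  set i := min #X ⌊q / M * n⌋₊ with hi
  have hqn : 1 ≤ q / M * n := by
    rw [div_mul_eq_mul_div, le_div_iff₀ hM0, one_mul]
    rwa [div_le_iff₀' hq] at hn
  have hi1 : 1 ≤ i := le_min hX.card_pos ((Nat.one_le_floor_iff _).2 hqn)
  have hiX : i ≤ #X := min_le_left _ _
  have hin : i ≤ n := hiX.trans (card_le_univ X)
  have hi2 : (i : ℝ) ≤ q / M * n :=
    (Nat.cast_le.2 (min_le_right _ _)).trans (Nat.floor_le (by positivity))
  have hdi := h i hi1 hi2
  have hlow : t ≤ d i := by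
    refine le_trans ?_ hdi
    rcases min_choice #X ⌊q / M * n⌋₊ with h' | h'
    · rw [hi, h', ht]
      linarith [min_le_left ((1 - (p + q) / M) * n + p / q * #X) ((1 - q / M) * n)]
    · have h1 : q / M * n - 1 ≤ i := by
        rw [hi, h']
        exact (Nat.sub_one_lt_floor _).le
      have h2 : p / q * (q / M * n - 1) ≤ p / q * i := mul_le_mul_of_nonneg_left h1 hpq0.le
      have h3 : p / q * (q / M * n) = p / M * n := by field_simp
      have h4 : (p + q) / M = p / M + q / M := add_div _ _ _
      rw [ht]
      have := min_le_right ((1 - (p + q) / M) * n + p / q * #X) ((1 - q / M) * n)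
      rw [mul_sub, h3] at h2
      have h5 : (1 - (p + q) / M) * n = n - p / M * n - q / M * n := by rw [h4]; ring
      linarith
  have hcard := hd.card_filter_lt t
  have h1 : i ≤ #{v | (G.degree v : ℝ) < t} :=
    hiX.trans (card_le_card fun x hx => by simpa using hcon x hx)
  -- As `d` is monotone and `t ≤ d i`, only `i - 1` indices can lie below `t`, yet `X` supplies at
  -- least `i` vertices of degree below `t`.
  have h2 : ({j ∈ Icc 1 n | (d j : ℝ) < t} : Finset ℕ) ⊆ Icc 1 (i - 1) := by
    intro j hj
    obtain ⟨hj1, hj2⟩ := mem_filter.1 hj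
    obtain ⟨hj3, hj4⟩ := mem_Icc.1 hj1
    refine mem_Icc.2 ⟨hj3, ?_⟩
    by_contra! hlt
    have := hd.1 (Set.mem_Icc.2 ⟨hi1, hin⟩) (Set.mem_Icc.2 ⟨hj3, hj4⟩) (by lia : i ≤ j)
    have : (d i : ℝ) ≤ d j := by exact_mod_cast this
    linarith
  have h3 := card_le_card h2
  rw [hcard, Nat.card_Icc] at h3
  lia

section Reduced

variable {V I : Type*} [Fintype V] [DecidableEq V] [Fintype I] [DecidableEq I]
  {G : SimpleGraph V} [DecidableRel G.Adj] {C : I → Finset V} {ε d : ℝ}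

/-- The graph on the clusters `C a` whose edges are the dense regular pairs. -/
def reducedGraph (G : SimpleGraph V) [DecidableRel G.Adj] (C : I → Finset V) (ε d : ℝ) :
    SimpleGraph I where
  Adj a b := a ≠ b ∧ G.IsUniform ε (C a) (C b) ∧ d ≤ G.edgeDensity (C a) (C b)
  symm := ⟨fun _ _ h => ⟨h.1.symm, h.2.1.symm, by rw [edgeDensity_comm]; exact h.2.2⟩⟩
  loopless := ⟨fun _ h => h.1 rfl⟩

open scoped Classical in
/-- The clusters forming an irregular pair with `a`. -/
noncomputable def irregularPartners (G : SimpleGraph V) [DecidableRel G.Adj] (C : I → Finset V)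
    (ε : ℝ) (a : I) : Finset I := {b | a ≠ b ∧ ¬ G.IsUniform ε (C a) (C b)}

open scoped Classical in
/-- The clusters `b` forming a sparse regular pair with `a`, into which `x` has large degree. -/
noncomputable def densePartners (G : SimpleGraph V) [DecidableRel G.Adj] (C : I → Finset V)
    (ε d : ℝ) (a : I) (x : V) : Finset I :=
  {b | G.IsUniform ε (C a) (C b) ∧ (G.edgeDensity (C a) (C b) : ℝ) < d ∧
    (d + ε) * #(C b) < #{v ∈ C b | G.Adj x v}}

open scoped Classical in
/-- The clusters which form an irregular pair with many others. -/
noncomputable def irregularClusters (G : SimpleGraph V) [DecidableRel G.Adj] (C : I → Finset V)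
    (ε : ℝ) : Finset I :=
  {a | ε * Fintype.card I < #(irregularPartners G C (ε ^ 2) a)}

open scoped Classical in
/-- The vertices of `C a` with large degree into many clusters in sparse regular pairs. -/
noncomputable def atypicalVerts (G : SimpleGraph V) [DecidableRel G.Adj] (C : I → Finset V)
    (ε d : ℝ) (a : I) : Finset V :=
  {x ∈ C a | ε * Fintype.card I < #(densePartners G C (ε ^ 2) d a x)}

lemma card_mul_le_of_sum {α : Type*} {s : Finset α} {f : α → ℝ} {t B : ℝ} (hf : ∀ a ∈ s, t ≤ f a)
    (hB : ∑ a ∈ s, f a ≤ B) : #s * t ≤ B := by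
  rw [← nsmul_eq_mul]
  exact (card_nsmul_le_sum s f t hf).trans hB

/-- Markov's inequality: regularity with parameter `ε ^ 2` leaves a proportion `ε` for both the
threshold and the exceptional set. -/
lemma card_irregularClusters_le (hε : 0 < ε) [Nonempty I]
    (h : ∑ a, (#(irregularPartners G C (ε ^ 2) a) : ℝ) ≤ ε ^ 2 * Fintype.card I ^ 2) :
    (#(irregularClusters G C ε) : ℝ) ≤ ε * Fintype.card I := by
  have hk : (0 : ℝ) < Fintype.card I := by exact_mod_cast Fintype.card_pos
  have h1 := card_mul_le_of_sum (s := irregularClusters G C ε) (fun a ha => (mem_filter.1 ha).2.le)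
    ((sum_le_sum_of_subset_of_nonneg (subset_univ _) fun _ _ _ => by positivity).trans h)
  refine le_of_mul_le_mul_right (h1.trans (le_of_eq ?_)) (mul_pos hε hk)
  ring

lemma card_atypicalVerts_le (hε : 0 < ε) (hε1 : ε ≤ 1) [Nonempty I] {a : I}
    (ha : (C a).Nonempty) :
    (#(atypicalVerts G C ε d a) : ℝ) ≤ ε * #(C a) := by
  classical
  have hk : (0 : ℝ) < Fintype.card I := by exact_mod_cast Fintype.card_pos
  have hsum : ∑ x ∈ C a, (#(densePartners G C (ε ^ 2) d a x) : ℝ) ≤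
      Fintype.card I * (#(C a) * ε ^ 2) := by
    simp only [densePartners, card_filter, Nat.cast_sum]
    rw [sum_comm, ← nsmul_eq_mul, ← card_univ]
    refine sum_le_card_nsmul _ _ _ fun b _ => ?_
    by_cases h : G.IsUniform (ε ^ 2) (C a) (C b) ∧ (G.edgeDensity (C a) (C b) : ℝ) < d
    · have := h.1.card_highDegree_lt h.2 (pow_le_one₀ hε.le hε1) ha
      rw [card_filter] at this
      push_cast at this ⊢
      simpa [h.1, h.2] using this.le
    · have h' : ∀ P : Prop, ¬ (G.IsUniform (ε ^ 2) (C a) (C b) ∧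
        (G.edgeDensity (C a) (C b) : ℝ) < d ∧ P) := fun P hP => h ⟨hP.1, hP.2.1⟩
      simp only [h', if_false]
      simp only [Nat.cast_zero, sum_const_zero]
      positivity
  have h1 := card_mul_le_of_sum (s := atypicalVerts G C ε d a) (fun a ha => (mem_filter.1 ha).2.le)
    ((sum_le_sum_of_subset_of_nonneg (filter_subset _ _) fun _ _ _ => by positivity).trans hsum)
  refine le_of_mul_le_mul_right (h1.trans (le_of_eq ?_)) (mul_pos hε hk)
  ring

/-- Neighbours of `x` lie in clusters adjacent to `a`, in `a` itself, in irregular partners, or in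
sparse pairs where `x` is exceptional, each contributing at most `s`; the remaining clusters
contribute a proportion at most `d + ε ^ 2`. -/
lemma degree_le_of_clusters (hd : 0 ≤ d) (hcov : ∀ v, ∃ a, v ∈ C a)
    (hdisj : Pairwise fun a b => Disjoint (C a) (C b)) {s : ℝ} (hs : ∀ a, (#(C a) : ℝ) ≤ s)
    (a : I) (x : V) :
    (G.degree x : ℝ) ≤ (degIn (reducedGraph G C (ε ^ 2) d) univ a + 1 +
      #(irregularPartners G C (ε ^ 2) a) + #(densePartners G C (ε ^ 2) d a x)) * s +
      (d + ε ^ 2) * Fintype.card V := by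
  classical
  have hs0 : 0 ≤ s := (Nat.cast_nonneg _).trans (hs a)
  have hdeg : (G.degree x : ℝ) ≤ ∑ b, (#{v ∈ C b | G.Adj x v} : ℝ) := by
    have : G.neighborFinset x ⊆ univ.biUnion fun b => {v ∈ C b | G.Adj x v} := by
      intro v hv
      obtain ⟨b, hb⟩ := hcov v
      simp only [mem_biUnion, mem_univ, true_and, mem_filter]
      exact ⟨b, hb, by simpa using hv⟩
    rw [← G.card_neighborFinset_eq_degree x]
    exact_mod_cast (card_le_card this).trans card_biUnion_le
  have hV : ∑ b, (#(C b) : ℝ) = Fintype.card V := by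
    rw [← card_univ]
    have : (univ : Finset V) = univ.biUnion C := by
      ext v
      simpa using hcov v
    rw [this, card_biUnion fun a _ b _ hab => hdisj hab]
    push_cast
    rfl
  refine hdeg.trans ?_
  rw [← hV, mul_sum]
  set E : Finset I := (({b ∈ (univ : Finset I) | (reducedGraph G C (ε ^ 2) d).Adj a b} ∪ {a}) ∪
    irregularPartners G C (ε ^ 2) a) ∪ densePartners G C (ε ^ 2) d a x with hE
  have hEc : (#E : ℝ) ≤ degIn (reducedGraph G C (ε ^ 2) d) univ a + 1 +
      #(irregularPartners G C (ε ^ 2) a) + #(densePartners G C (ε ^ 2) d a x) := by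
    have : #E ≤ degIn (reducedGraph G C (ε ^ 2) d) univ a + 1 +
        #(irregularPartners G C (ε ^ 2) a) + #(densePartners G C (ε ^ 2) d a x) := by
      refine (card_union_le _ _).trans (Nat.add_le_add_right ?_ _)
      refine (card_union_le _ _).trans (Nat.add_le_add_right ?_ _)
      exact card_union_le _ _
    exact_mod_cast this
  calc ∑ b, (#{v ∈ C b | G.Adj x v} : ℝ) ≤
        ∑ b, ((if b ∈ E then s else 0) + (d + ε ^ 2) * #(C b)) := by
        refine sum_le_sum fun b _ => ?_
        have h0 : 0 ≤ (d + ε ^ 2) * #(C b) := by positivity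
        split_ifs with hb
        · have : (#{v ∈ C b | G.Adj x v} : ℝ) ≤ #(C b) := by
            exact_mod_cast card_filter_le _ _
          linarith [hs b]
        · simp only [hE, mem_union, not_or, mem_singleton] at hb
          obtain ⟨⟨⟨h1, h2⟩, h3⟩, h4⟩ := hb
          have hab : a ≠ b := fun h => h2 h.symm
          have hu : G.IsUniform (ε ^ 2) (C a) (C b) := by
            by_contra h
            exact h3 (mem_filter.2 ⟨mem_univ b, hab, h⟩)
          have hsparse : (G.edgeDensity (C a) (C b) : ℝ) < d := by
            by_contra! h
            exact h1 (mem_filter.2 ⟨mem_univ b, hab, hu, h⟩)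
          rw [zero_add]
          by_contra! h
          exact h4 (mem_filter.2 ⟨mem_univ b, hu, hsparse, h⟩)
    _ = #E * s + ∑ b, (d + ε ^ 2) * #(C b) := by
        rw [sum_add_distrib, ← sum_filter]
        simp
    _ ≤ _ := by
        gcongr

set_option maxHeartbeats 400000 in
/-- The reduced graph inherits the degree condition. -/
theorem exists_le_degIn_reducedGraph [Nonempty I] {p q M : ℝ} (hp : 0 < p) (hpq : p ≤ q)
    (hM : p + q ≤ M) (hε : 0 < ε) (hε1 : ε ≤ 1 / 2) (hd : 0 ≤ d)
    (hcov : ∀ v, ∃ a, v ∈ C a) (hdisj : Pairwise fun a b => Disjoint (C a) (C b))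
    (hup : ∀ a, (#(C a) : ℝ) ≤ Fintype.card V / Fintype.card I + 1)
    (hlo : ∀ a, (Fintype.card V / Fintype.card I - 1 : ℝ) ≤ #(C a))
    (hk : 1 ≤ ε * Fintype.card I) (hn : Fintype.card I ≤ ε * Fintype.card V)
    (hG : ∀ X : Finset V, X.Nonempty → ∃ x ∈ X,
      min ((1 - (p + q) / M) * Fintype.card V + p / q * #X)
      ((1 - q / M) * Fintype.card V) - 1 ≤ G.degree x)
    (hirr : ∑ a, (#(irregularPartners G C (ε ^ 2) a) : ℝ) ≤ ε ^ 2 * Fintype.card I ^ 2)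
    {S : Finset I} (hS : S = univ \ irregularClusters G C ε) {F : Finset I} (hF : F ⊆ S)
    (hne : F.Nonempty) :
    ∃ a ∈ F, min ((1 - (p + q) / M) * #S + p / q * #F) ((1 - q / M) * #S) -
      (d + 13 * ε) * Fintype.card I ≤ degIn (reducedGraph G C (ε ^ 2) d) S a := by
  classical
  have hq : 0 < q := hp.trans_le hpq
  have hM0 : 0 < M := by linarith
  have hpq1 : p / q ≤ 1 := (div_le_one hq).2 hpq
  have hpq0 : 0 < p / q := by positivity
  set k : ℝ := ((Fintype.card I : ℕ) : ℝ) with hk'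
  set n : ℝ := ((Fintype.card V : ℕ) : ℝ) with hn'
  have hk0 : 0 < k := by
    rw [hk']; exact_mod_cast Fintype.card_pos
  have hn0 : 0 < n := by
    by_contra! h
    nlinarith
  have hnk : 2 ≤ n / k := by
    rw [le_div_iff₀ hk0]
    nlinarith
  have hCne : ∀ a, (C a).Nonempty := fun a => by
    rw [← card_pos]
    have : (0 : ℝ) < #(C a) := by linarith [hlo a]
    exact_mod_cast this
  let typ : I → Finset V := fun a => C a \ atypicalVerts G C ε d a
  have htyp : ∀ a, (1 - ε) * (n / k - 1) ≤ #(typ a) := fun a => by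
    have h1 := card_atypicalVerts_le (G := G) (d := d) hε (by linarith) (hCne a)
    have h2 : (#(typ a) : ℝ) + #(atypicalVerts G C ε d a) = #(C a) := by
      exact_mod_cast card_sdiff_add_card_eq_card (filter_subset _ _)
    have h3 : (1 - ε) * (n / k - 1) ≤ (1 - ε) * #(C a) :=
      mul_le_mul_of_nonneg_left (hlo a) (by linarith)
    linarith
  -- Apply the vertex condition to the typical vertices of the clusters in `F`, about `#F * (n / k)`
  -- of them; the cluster of the vertex found is the one sought.
  set X : Finset V := F.biUnion typ with hX
  have hFk : (#F : ℝ) ≤ k := by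
    rw [hk']; exact_mod_cast card_le_univ F
  have hSk : (#S : ℝ) ≤ k := by
    rw [hk']; exact_mod_cast card_le_univ S
  have hXc : #F * (n / k) - 2 * (ε * n) ≤ #X := by
    have h1 : #X = ∑ a ∈ F, #(typ a) := card_biUnion fun a _ b _ hab =>
      (hdisj hab).mono sdiff_subset sdiff_subset
    have h2 : #F * ((1 - ε) * (n / k - 1)) ≤ ∑ a ∈ F, (#(typ a) : ℝ) :=
      card_mul_le_of_sum (fun a _ => htyp a) le_rfl
    rw [h1]
    push_cast
    refine le_trans ?_ h2
    have h3 : #F * (n / k) * ε ≤ n * ε := by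
      refine mul_le_mul_of_nonneg_right ?_ hε.le
      calc #F * (n / k) ≤ k * (n / k) := by gcongr
        _ = n := by field_simp
    have h4 : (0 : ℝ) ≤ #F * ε := by positivity
    nlinarith
  have hXne : X.Nonempty := by
    obtain ⟨a, ha⟩ := hne
    have h1 : (0 : ℝ) < #(typ a) :=
      (mul_pos (by linarith) (by linarith)).trans_le (htyp a)
    have h2 : (typ a).Nonempty := by
      rw [← card_pos]; exact_mod_cast h1
    exact h2.mono (subset_biUnion_of_mem typ ha)
  obtain ⟨x, hxX, hx⟩ := hG X hXne
  obtain ⟨a, haF, hxa⟩ := mem_biUnion.1 hxX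
  refine ⟨a, haF, ?_⟩
  have hdense : (#(densePartners G C (ε ^ 2) d a x) : ℝ) ≤ ε * k := by
    by_contra! h
    exact (mem_sdiff.1 hxa).2 (mem_filter.2 ⟨(mem_sdiff.1 hxa).1, h⟩)
  have hirra : (#(irregularPartners G C (ε ^ 2) a) : ℝ) ≤ ε * k := by
    have := hF haF
    rw [hS] at this
    by_contra! h
    exact (mem_sdiff.1 this).2 (mem_filter.2 ⟨mem_univ a, h⟩)
  have hdegS : (degIn (reducedGraph G C (ε ^ 2) d) univ a : ℝ) ≤
      degIn (reducedGraph G C (ε ^ 2) d) S a + ε * k := by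
    have h1 := card_irregularClusters_le (G := G) (C := C) hε hirr
    have h2 : degIn (reducedGraph G C (ε ^ 2) d) univ a ≤
        degIn (reducedGraph G C (ε ^ 2) d) S a +
        #(irregularClusters G C ε) := by
      unfold degIn
      refine (card_le_card fun b hb => ?_).trans (card_union_le _ _)
      simp only [mem_union, mem_filter, mem_univ, true_and, hS, mem_sdiff] at hb ⊢
      tauto
    have h3 : (degIn (reducedGraph G C (ε ^ 2) d) univ a : ℝ) ≤
        degIn (reducedGraph G C (ε ^ 2) d) S a +
        #(irregularClusters G C ε) := by
      exact_mod_cast h2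
    linarith
  have hdeg := degree_le_of_clusters (ε := ε) (G := G) hd hcov hdisj hup a x
  set D : ℝ := ((degIn (reducedGraph G C (ε ^ 2) d) S a : ℕ) : ℝ) with hD
  have hDk : D ≤ k := by
    rw [hD, hk']
    exact_mod_cast card_le_univ _
  have hε2 : ε ^ 2 ≤ ε := by nlinarith
  have hnk' : n / k ≤ ε * n := by
    rw [div_le_iff₀ hk0]
    nlinarith
  have hdeg' : (G.degree x : ℝ) ≤ D * (n / k) + (d + 10 * ε) * n := by
    have h1 : (degIn (reducedGraph G C (ε ^ 2) d) univ a + 1 +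
        #(irregularPartners G C (ε ^ 2) a) + #(densePartners G C (ε ^ 2) d a x) : ℝ) ≤
        D + 1 + 3 * (ε * k) := by linarith
    have h2 := mul_le_mul_of_nonneg_right h1 (show 0 ≤ n / k + 1 by linarith)
    have h3 : (ε * k) * (n / k) = ε * n := by field_simp
    have h4 : (d + ε ^ 2) * n ≤ (d + ε) * n := by gcongr
    have h5 : ε * k ≤ k := mul_le_of_le_one_left hk0.le (by linarith)
    nlinarith
  have hmain : min ((1 - (p + q) / M) * n + p / q * #X) ((1 - q / M) * n) ≤
      D * (n / k) + (d + 11 * ε) * n := by nlinarith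
  -- Divide by the average cluster size `n / k`. The `13` is `10` from `hdeg'`, `1` for the `- 1` in
  -- `hG`, and `2` from the loss in `#X`.
  have hscale : ∀ t : ℝ, t * (n / k) ≤ D * (n / k) + (d + 13 * ε) * n →
      t - (d + 13 * ε) * k ≤ D := by
    intro t ht
    have h1 : (d + 13 * ε) * n = (d + 13 * ε) * k * (n / k) := by field_simp
    rw [h1, ← add_mul] at ht
    linarith [le_of_mul_le_mul_right ht (by linarith)]
  have hnkk : k * (n / k) = n := by field_simp
  have hM1 : 0 ≤ 1 - (p + q) / M := by
    rw [sub_nonneg, div_le_one hM0]; exact hM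
  have hM2 : 0 ≤ 1 - q / M := by
    rw [sub_nonneg, div_le_one hM0]; linarith
  have hSn : #S * (n / k) ≤ n := by
    calc #S * (n / k) ≤ k * (n / k) := by gcongr
      _ = n := hnkk
  have hεn : 0 < ε * n := mul_pos hε hn0
  apply hscale
  rcases min_le_iff.1 hmain with h | h
  · refine (mul_le_mul_of_nonneg_right (min_le_left _ _) (by linarith)).trans ?_
    have h1 := mul_le_mul_of_nonneg_left hSn hM1
    have h2 := mul_le_mul_of_nonneg_left hXc hpq0.le
    have h3 : p / q * (2 * (ε * n)) ≤ 2 * (ε * n) :=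
      mul_le_of_le_one_left (by linarith) hpq1
    linarith
  · refine (mul_le_mul_of_nonneg_right (min_le_right _ _) (by linarith)).trans ?_
    have h1 := mul_le_mul_of_nonneg_left hSn hM2
    linarith

end Reduced

end SimpleGraph

/-! ### The bottle labelling and the regular partition. -/

namespace SimpleGraph
open FracTiling

/-- Rotating the larger colour classes balances a colouring into the shape of a bottle. -/
theorem exists_bottle_labelling {W : Type*} [Fintype W] (H : SimpleGraph W) (s : ℕ) [NeZero s]
    (hr : H.chromaticNumber = (s + 1 : ℕ)) :
    ∃ l : W × Fin s → Option (Fin s), (∀ u v k, H.Adj u v → l (u, k) ≠ l (v, k)) ∧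
      #{x | l x = none} = s * H.minColorClassSize ∧
      (∀ j, #{x | l x = some j} + H.minColorClassSize = Fintype.card W) ∧
      1 ≤ H.minColorClassSize ∧ (s + 1) * H.minColorClassSize ≤ Fintype.card W := by
  classical
  have htn : H.chromaticNumber.toNat = s + 1 := by rw [hr]; rfl
  have hcol : H.Colorable (s + 1) := by
    rw [← chromaticNumber_le_iff_colorable, hr]
  have hmin : ∃ (D : H.Coloring (Fin (s + 1))) (c : Fin (s + 1)),
      H.minColorClassSize = (D.colorClass c).ncard ∧
      ∀ b, H.minColorClassSize ≤ (D.colorClass b).ncard := by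
    unfold minColorClassSize
    rw [htn]
    obtain ⟨D, c, h⟩ := Nat.sInf_mem (s := {m : ℕ | ∃ (D : H.Coloring (Fin (s + 1)))
      (c : Fin (s + 1)), m = (D.colorClass c).ncard}) ⟨_, hcol.some, 0, rfl⟩
    exact ⟨D, c, h, fun b => Nat.sInf_le ⟨D, b, rfl⟩⟩
  obtain ⟨D, c, hc, hle⟩ := hmin
  set σ := H.minColorClassSize with hσ
  have hfib : ∀ b, (D.colorClass b).ncard = #{w | D w = b} := fun b => by
    rw [← Set.ncard_coe_finset]
    congr 1
    ext w
    simp [Coloring.colorClass]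
  have hσ1 : 1 ≤ σ := by
    rw [hc, hfib, Nat.one_le_iff_ne_zero, Ne, card_eq_zero]
    intro h0
    have hD : ∀ w, D w ≠ c := fun w hw => by
      have : w ∈ ({w | D w = c} : Finset W) := by simp [hw]
      simp [h0] at this
    -- An empty class would leave a proper colouring with only `s` colours.
    have hcol' : H.Colorable (Fintype.card {b // b ≠ c}) :=
      Coloring.colorable (Coloring.mk (fun w => (⟨D w, hD w⟩ : {b // b ≠ c}))
        fun {u v} huv h => D.valid huv (by simpa using h))
    have := chromaticNumber_le_iff_colorable.2 hcol'
    rw [hr] at this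
    have := Nat.cast_le.1 this
    simp at this
  have hsum : ∑ b, #{w | D w = b} = Fintype.card W :=
    (card_eq_sum_card_fiberwise (f := D) (t := univ) (by simp)).symm
  -- The smallest class `c` is labelled `none` in every copy; the other classes are shifted
  -- cyclically by the copy number, so over `s` copies each label `some j` receives each of them
  -- once.
  refine ⟨fun x => (finSuccEquiv' c (D x.1)).map (· + x.2), ?_, ?_, ?_, hσ1, ?_⟩
  · intro u v k huv h
    exact D.valid huv ((finSuccEquiv' c).injective
      (Option.map_injective (add_left_injective k) h))
  · have : ({x : W × Fin s | (finSuccEquiv' c (D x.1)).map (· + x.2) = none} : Finset _) =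
        ({w | D w = c} : Finset W) ×ˢ univ := by
      ext ⟨w, k⟩
      simp only [mem_filter, mem_univ, true_and, mem_product, and_true, Option.map_eq_none_iff]
      rw [← finSuccEquiv'_at c, (finSuccEquiv' c).injective.eq_iff]
    rw [this, card_product, ← hfib, ← hc, card_univ, Fintype.card_fin, mul_comm]
  · intro j
    have h1 : #{x : W × Fin s | (finSuccEquiv' c (D x.1)).map (· + x.2) = some j} =
        #{w | D w ≠ c} := by
      -- Each vertex outside class `c` gets label `j` in exactly one copy. The default `0` is never
      -- used for such vertices.
      refine card_nbij' (fun x => x.1)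
        (fun w => (w, j - ((finSuccEquiv' c (D w)).getD 0))) ?_ ?_ ?_ ?_
      · rintro ⟨w, k⟩ h
        simp only [coe_filter, mem_univ, true_and] at h ⊢
        intro hw
        simp [hw] at h
      · intro w h
        simp only [coe_filter, mem_univ, true_and] at h ⊢
        obtain ⟨a, ha⟩ : ∃ a, finSuccEquiv' c (D w) = some a := by
          rw [← Option.ne_none_iff_exists', ← finSuccEquiv'_at c]
          exact fun h' => h ((finSuccEquiv' c).injective h')
        change Option.map (· + (j - (finSuccEquiv' c (D w)).getD 0)) (finSuccEquiv' c (D w)) =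
          some j
        rw [ha]
        simp
      · rintro ⟨w, k⟩ h
        simp only [coe_filter, mem_univ, true_and] at h ⊢
        obtain ⟨a, ha, rfl⟩ := Option.map_eq_some_iff.1 h
        simp [ha]
      · intro w _
        rfl
    rw [h1, hc, hfib, add_comm]
    exact card_filter_add_card_filter_not (s := univ) fun w => D w = c
  · rw [← hsum]
    calc (s + 1) * σ = ∑ _b : Fin (s + 1), σ := by simp
      _ ≤ _ := sum_le_sum fun b _ => (hle b).trans (hfib b).le

/-- Szemerédi's regularity lemma, with the parts indexed by `Fin k`. -/
theorem exists_regular_clusters {ε : ℝ} (hε : 0 < ε) (l : ℕ) :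
    ∃ B : ℕ, ∀ (V : Type*) [Fintype V] [DecidableEq V] (G : SimpleGraph V) [DecidableRel G.Adj],
      l ≤ Fintype.card V → ∃ (k : ℕ) (C : Fin k → Finset V), l ≤ k ∧ k ≤ B ∧
        (∀ v, ∃ a, v ∈ C a) ∧ (Pairwise fun a b => Disjoint (C a) (C b)) ∧
        (∀ a, (#(C a) : ℝ) ≤ Fintype.card V / k + 1) ∧
        (∀ a, (Fintype.card V / k - 1 : ℝ) ≤ #(C a)) ∧
        ∑ a, (#(irregularPartners G C ε a) : ℝ) ≤ ε * k ^ 2 := by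
  refine ⟨SzemerediRegularity.bound ε l, fun V _ _ G _ hl => ?_⟩
  obtain ⟨P, hP, hlk, hkB, hU⟩ := szemeredi_regularity G hε hl
  set e := P.parts.equivFin with he
  have hinj : Function.Injective fun a : Fin #P.parts => (e.symm a).1 :=
    Subtype.val_injective.comp e.symm.injective
  refine ⟨#P.parts, fun a => (e.symm a).1, hlk, hkB, ?_, ?_, ?_, ?_, ?_⟩
  · intro v
    obtain ⟨t, ht, hv⟩ := P.exists_mem (mem_univ v)
    exact ⟨e ⟨t, ht⟩, by simpa using hv⟩
  · intro a b hab
    exact P.disjoint (e.symm a).2 (e.symm b).2 (hinj.ne hab)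
  · intro a
    have h1 := hP.card_part_le_average_add_one (e.symm a).2
    rw [card_univ] at h1
    have h2 : ((Fintype.card V / #P.parts : ℕ) : ℝ) ≤ Fintype.card V / #P.parts := Nat.cast_div_le
    have h3 : (#(e.symm a).1 : ℝ) ≤ (Fintype.card V / #P.parts : ℕ) + 1 := by exact_mod_cast h1
    linarith
  · intro a
    have h1 := hP.average_le_card_part (e.symm a).2
    rw [card_univ] at h1
    have h2 : (Fintype.card V / #P.parts : ℝ) < (Fintype.card V / #P.parts : ℕ) + 1 := by
      rw [← Nat.floor_div_eq_div (K := ℝ)]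
      exact Nat.lt_floor_add_one _
    have h3 : ((Fintype.card V / #P.parts : ℕ) : ℝ) ≤ #(e.symm a).1 := by exact_mod_cast h1
    linarith
  · have h1 : ∑ a, #(irregularPartners G (fun a => (e.symm a).1) ε a) ≤ #(P.nonUniforms G ε) := by
      rw [← card_sigma]
      refine card_le_card_of_injOn (fun x => ((e.symm x.1).1, (e.symm x.2).1)) ?_ ?_
      · rintro ⟨a, b⟩ hx
        have hx := (mem_sigma.1 (mem_coe.1 hx)).2
        obtain ⟨hab, hu⟩ := (mem_filter.1 hx).2
        exact mem_coe.2 ((P.mk_mem_nonUniforms G).2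
          ⟨(e.symm a).2, (e.symm b).2, hinj.ne hab, hu⟩)
      · rintro ⟨a, b⟩ - ⟨a', b'⟩ - h
        obtain ⟨h1, h2⟩ := Prod.ext_iff.1 h
        obtain rfl : a = a' := hinj h1
        obtain rfl : b = b' := hinj h2
        rfl
    have h2 : (∑ a, (#(irregularPartners G (fun a => (e.symm a).1) ε a) : ℝ)) ≤
        #(P.nonUniforms G ε) := by exact_mod_cast h1
    have h3 : (#(P.nonUniforms G ε) : ℝ) ≤ (#P.parts * (#P.parts - 1) : ℕ) * ε := hU
    have h4 : ((#P.parts * (#P.parts - 1) : ℕ) : ℝ) ≤ (#P.parts : ℝ) ^ 2 := by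
      rw [sq]
      exact_mod_cast Nat.mul_le_mul_left _ (Nat.sub_le _ _)
    have h5 := mul_le_mul_of_nonneg_right h4 hε.le
    linarith

end SimpleGraph

/-! ### Assembly and choice of constants. -/

namespace SimpleGraph
open FracTiling

/-- The tiling theorem for a graph with a given regular partition. -/
theorem exists_isTiling_of_clusters {V I W κ ι : Type*} [Fintype V] [DecidableEq V]
    {G : SimpleGraph V} [DecidableRel G.Adj] [Fintype I] [DecidableEq I] [Nonempty I]
    [Fintype W] [DecidableEq W] [Fintype κ] [DecidableEq κ] [Fintype ι] [DecidableEq ι]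
    {H : SimpleGraph W} {l : W × κ → ι}
    (hl : ∀ u v k, H.Adj u v → l (u, k) ≠ l (v, k)) {c : ι → ℝ} {i₀ : ι} {p q M : ℝ}
    (hc : ∀ i, c i = #{x | l x = i}) (hcb : c = bottleWeight i₀ p q) (hMc : M = ∑ i, c i)
    (hp : 0 < p) (hpq : p ≤ q) (hM : p + q ≤ M)
    {C : I → Finset V} {ε d γ β : ℝ} (hε : 0 < ε) (hε1 : ε ≤ 1 / 2)
    (hγ0 : 0 < γ) (hγ : γ ≤ 1 / 2) (hγd : γ ≤ d - ε ^ 2) (hβ0 : 0 ≤ β) (hβ1 : β ≤ 1)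
    (hcov : ∀ v, ∃ a, v ∈ C a) (hdisj : Pairwise fun a b => Disjoint (C a) (C b))
    (hup : ∀ a, (#(C a) : ℝ) ≤ Fintype.card V / Fintype.card I + 1)
    (hlo : ∀ a, (Fintype.card V / Fintype.card I - 1 : ℝ) ≤ #(C a))
    (hk : 1 ≤ ε * Fintype.card I) (hn : Fintype.card I ≤ ε * Fintype.card V)
    (hG : ∀ X : Finset V, X.Nonempty → ∃ x ∈ X,
      min ((1 - (p + q) / M) * Fintype.card V + p / q * #X)
      ((1 - q / M) * Fintype.card V) - 1 ≤ G.degree x)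
    (hirr : ∑ a, (#(irregularPartners G C (ε ^ 2) a) : ℝ) ≤ ε ^ 2 * Fintype.card I ^ 2)
    (hεβ : ε ^ 2 * (Fintype.card ι + 1) ≤ β * γ ^ Fintype.card (W × κ))
    (h2 : 2 ≤ β * γ ^ Fintype.card (W × κ) * (Fintype.card V / Fintype.card I - 1)) :
    ∃ (T : Set G.Subgraph) (U : Finset V), IsTiling H G T ∧ coveredVerts T = U ∧
      Fintype.card V - (β + ε + M / q * (M / p) * (d + 13 * ε) +
        ((M / p + 1) * M / q + 2) * (M / p) / Fintype.card I) * Fintype.card V -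
        Fintype.card I - M * Fintype.card (ι → I) ≤ (#U : ℝ) := by
  classical
  have hq : 0 < q := hp.trans_le hpq
  have hM0 : 0 < M := by linarith
  have hd : 0 ≤ d := by nlinarith [sq_nonneg ε]
  set k : ℝ := ((Fintype.card I : ℕ) : ℝ) with hk'
  set n : ℝ := ((Fintype.card V : ℕ) : ℝ) with hn'
  have hk0 : 0 < k := by
    rw [hk']; exact_mod_cast Fintype.card_pos
  have hn0 : 0 ≤ n := by positivity
  have hβγ : 0 ≤ β * γ ^ Fintype.card (W × κ) := by positivity
  have hm0 : 0 ≤ n / k - 1 := by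
    by_contra! h
    have := mul_nonpos_of_nonneg_of_nonpos hβγ h.le
    linarith
  have hCne : ∀ a, (C a).Nonempty := fun a => by
    rw [nonempty_iff_ne_empty]
    intro h0
    have h1 := hlo a
    rw [h0, card_empty, Nat.cast_zero] at h1
    have := mul_nonpos_of_nonneg_of_nonpos hβγ h1
    linarith
  have : Nonempty ι := ⟨i₀⟩
  set S : Finset I := univ \ irregularClusters G C ε with hS
  set g : ℝ := (d + 13 * ε) * k with hg
  have hg0 : 0 ≤ g := by positivity
  obtain ⟨w, hw, hu⟩ := hasDefect_of_degIn (R := reducedGraph G C (ε ^ 2) d) (S := S) hp hpq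
    (hMc ▸ hM) hcb hg0 fun F hF hne => by
      rw [← hMc]
      exact exists_le_degIn_reducedGraph hp hpq hM hε hε1 hd hcov hdisj hup hlo hk hn hG hirr hS
        hF hne
  rw [← hMc] at hu
  obtain ⟨T, U, hT, hTU, hU⟩ := exists_isTiling_of_isFracTiling (G := G) hl hm0 hβ1 hlo
    (fun φ hφ A hA hAβ => by
      obtain ⟨f, hf1, hf2, hf3⟩ := exists_embedding_of_isUniform (G := G) hγ0 hγ hγd
        (C := fun i => C (φ i)) (fun i j hij => (hφ.2 i j hij).2) (fun i => hCne _)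
        (by positivity) l univ A β hβ0 hA (by simpa using hεβ)
        (fun i => by
          rw [card_univ]
          exact h2.trans (mul_le_mul_of_nonneg_left (hlo _) hβγ)) hAβ
      exact ⟨f, fun x y h => hf1 (mem_coe.2 (mem_univ x)) (mem_coe.2 (mem_univ y)) h,
        fun x => hf2 x (mem_univ x), fun x y => hf3 x (mem_univ x) y (mem_univ y)⟩)
    hdisj hc hw
  refine ⟨T, U, hT, hTU, le_trans ?_ hU⟩
  rw [← hMc]
  set Wt := ∑ φ, w φ
  set K₀ := ((M / p + 1) * M / q + 2) * (M / p) with hK₀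
  have hS1 : k - ε * k ≤ #S := by
    have h1 := card_irregularClusters_le (G := G) (C := C) hε hirr
    have h3 : (#S : ℝ) + #(irregularClusters G C ε) = k := by
      rw [hk', ← card_univ]
      exact_mod_cast card_sdiff_add_card_eq_card (subset_univ _)
    linarith
  -- The covered weight is at least `#S` minus the defect, and the defect bound is affine in `g = (d
  -- + 13 * ε) * k`.
  have hMW : k * (1 - (ε + M / q * (M / p) * (d + 13 * ε) + K₀ / k)) ≤ M * Wt := by
    have h1 : ((M / p + g + 1) * M / q + 2) * (M / p) =
        K₀ + k * (M / q * (M / p) * (d + 13 * ε)) := by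
      rw [hK₀, hg]; ring
    have h3 : k * (K₀ / k) = K₀ := by field_simp
    linarith
  set δ := ε + M / q * (M / p) * (d + 13 * ε) + K₀ / k with hδ
  have hδ0 : 0 ≤ δ := by positivity
  have h4 := mul_le_mul_of_nonneg_left hMW
    (mul_nonneg (show 0 ≤ 1 - β by linarith) hm0)
  have h5 : (1 - β) * (n / k - 1) * (k * (1 - δ)) = (1 - β) * (1 - δ) * (n - k) := by
    field_simp
  rw [h5] at h4
  have h6 : 0 ≤ β * δ * n := by positivity
  have h7 : 0 ≤ (1 - β) * δ * k := mul_nonneg (mul_nonneg (by linarith) hδ0) hk0.le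
  have h8 : 0 ≤ β * k := by positivity
  have h9 : β + ε + M / q * (M / p) * (d + 13 * ε) + K₀ / k = β + δ := by rw [hδ]; ring
  rw [h9]
  nlinarith

/-- An almost perfect tiling, for large graphs with a bottle-type degree condition. -/
theorem exists_isTiling_of_degree {W : Type*} [Fintype W] [DecidableEq W] {H : SimpleGraph W}
    {s : ℕ} {l : W × Fin s → Option (Fin s)} (hl : ∀ u v k, H.Adj u v → l (u, k) ≠ l (v, k))
    {c : Option (Fin s) → ℝ} {p q M : ℝ} (hc : ∀ i, c i = #{x | l x = i})
    (hc' : c = bottleWeight none p q) (hMc : M = ∑ i, c i) (hp : 0 < p) (hpq : p ≤ q)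
    (hM : p + q ≤ M) {η : ℝ} (hη : 0 < η) :
    ∃ n₀ : ℕ, ∀ (V : Type*) [Fintype V] (G : SimpleGraph V) [DecidableRel G.Adj],
      n₀ ≤ Fintype.card V →
      (∀ X : Finset V, X.Nonempty → ∃ x ∈ X,
        min ((1 - (p + q) / M) * Fintype.card V + p / q * #X)
        ((1 - q / M) * Fintype.card V) - 1 ≤ (G.degree x : ℝ)) →
      ∃ T : Set G.Subgraph, IsTiling H G T ∧
        ((coveredVerts T)ᶜ.ncard : ℝ) ≤ η * Fintype.card V := by
  classical
  have hq : 0 < q := hp.trans_le hpq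
  have hM0 : 0 < M := by linarith
  -- The allowance `η` is split into sixths: one each for `β`, `ε`, `K₁ * (δ + 13 * ε)`, `K₀ / k`,
  -- and the rounding terms `k + M * k ^ (s + 1)`, with one to spare. The bound `b / (s + 2)` on `ε`
  -- is what the embedding needs.
  set β : ℝ := min (η / 6) 1 with hβ
  have hβ0 : 0 < β := by positivity
  set K₀ := ((M / p + 1) * M / q + 2) * (M / p) with hK₀
  set K₁ := M / q * (M / p) with hK₁
  have hK₀0 : 0 < K₀ := by positivity
  have hK₁0 : 0 < K₁ := by positivity
  set δ : ℝ := min (1 / 2) (η / (12 * K₁)) with hδ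
  have hδ0 : 0 < δ := by positivity
  have hδ1 : δ ≤ 1 / 2 := min_le_left _ _
  have hδK : K₁ * δ ≤ η / 12 := by
    calc K₁ * δ ≤ K₁ * (η / (12 * K₁)) := by gcongr; exact min_le_right _ _
      _ = η / 12 := by field_simp
  set γ := δ / 2 with hγ
  set b : ℝ := β * γ ^ Fintype.card (W × Fin s) with hb
  have hb0 : 0 < b := by positivity
  set ε : ℝ := min (min (δ / 2) (η / 6)) (min (η / (12 * 13 * K₁)) (b / (s + 2))) with hε
  have hε0 : 0 < ε := by positivity
  have hεδ : ε ≤ δ / 2 := (min_le_left _ _).trans (min_le_left _ _)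
  have hεη : ε ≤ η / 6 := (min_le_left _ _).trans (min_le_right _ _)
  have hεK : K₁ * (13 * ε) ≤ η / 12 := by
    calc K₁ * (13 * ε) ≤ K₁ * (13 * (η / (12 * 13 * K₁))) := by
          gcongr; exact (min_le_right _ _).trans (min_le_left _ _)
      _ = η / 12 := by field_simp
  have hεb : ε * (s + 2) ≤ b := by
    rw [← le_div_iff₀ (by positivity)]
    exact (min_le_right _ _).trans (min_le_right _ _)
  have hε1 : ε ≤ 1 / 2 := by linarith
  have hεsq : ε ^ 2 ≤ ε := by nlinarith
  -- At least `m` clusters make `1 ≤ ε * k` and `K₀ / k ≤ η / 6`.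
  set m : ℕ := ⌈1 / ε⌉₊ + ⌈6 * K₀ / η⌉₊ + 1 with hm
  obtain ⟨B, hB⟩ := exists_regular_clusters (ε := ε ^ 2) (by positivity) m
  set N : ℝ := m + B / ε + B * (2 / b + 1) + 6 * (B + M * B ^ (s + 1)) / η with hN
  refine ⟨⌈N⌉₊, fun V _ G _ hn hG => ?_⟩
  have hnN : N ≤ Fintype.card V := (Nat.le_ceil _).trans (by exact_mod_cast hn)
  have hn1 : (m : ℝ) ≤ Fintype.card V ∧ B / ε ≤ Fintype.card V ∧
      B * (2 / b + 1) ≤ Fintype.card V ∧ 6 * (B + M * B ^ (s + 1)) / η ≤ Fintype.card V := by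
    have e2 : (0 : ℝ) ≤ B / ε := by positivity
    have e3 : (0 : ℝ) ≤ B * (2 / b + 1) := by positivity
    have e4 : 0 ≤ 6 * (B + M * B ^ (s + 1)) / η := by positivity
    have e5 : (0 : ℝ) ≤ m := by positivity
    refine ⟨?_, ?_, ?_, ?_⟩ <;> linarith
  obtain ⟨hnm, hnε, hnb, hnη⟩ := hn1
  obtain ⟨k, C, hmk, hkB, hcov, hdisj, hup, hlo, hirr⟩ := hB V G (by exact_mod_cast hnm)
  have hk1 : 1 ≤ k := le_trans (by lia) hmk
  have : Nonempty (Fin k) := ⟨⟨0, hk1⟩⟩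
  have hk0 : (0 : ℝ) < k := by exact_mod_cast hk1
  have hkB' : (k : ℝ) ≤ B := by exact_mod_cast hkB
  have hmk' : 1 / ε + 6 * K₀ / η ≤ k := by
    have h1 : (m : ℝ) ≤ k := by exact_mod_cast hmk
    rw [hm] at h1
    push_cast at h1
    linarith [Nat.le_ceil (1 / ε), Nat.le_ceil (6 * K₀ / η)]
  have hkε : 1 ≤ ε * k := by
    have : 1 / ε ≤ k := by
      have : 0 ≤ 6 * K₀ / η := by positivity
      linarith
    rwa [div_le_iff₀' hε0] at this
  have hnk : (k : ℝ) ≤ ε * Fintype.card V := by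
    rw [div_le_iff₀' hε0] at hnε
    linarith
  have h2 : 2 ≤ b * (Fintype.card V / k - 1) := by
    have e1 : (2 / b + 1) ≤ Fintype.card V / k := by
      rw [le_div_iff₀ hk0]
      refine le_trans ?_ hnb
      rw [mul_comm]
      gcongr
    calc 2 = b * (2 / b + 1 - 1) := by field_simp; ring
      _ ≤ _ := by gcongr
  obtain ⟨T, U, hT, hTU, hU⟩ := exists_isTiling_of_clusters (G := G) (ε := ε) (d := δ)
    (γ := γ) (β := β) hl hc hc' hMc hp hpq hM hε0 hε1 (by positivity) (by linarith)
    (by linarith) hβ0.le (min_le_right _ _) hcov hdisj (by simpa using hup) (by simpa using hlo)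
    (by simpa using hkε) (by simpa using hnk) hG (by simpa using hirr)
    (by
      rw [Fintype.card_option, Fintype.card_fin]
      push_cast
      have : ε ^ 2 * (s + 1 + 1) ≤ ε * (s + 1 + 1) := by gcongr
      linarith)
    (by simpa only [Fintype.card_fin] using h2)
  refine ⟨T, hT, ?_⟩
  have hcard : ((coveredVerts T)ᶜ.ncard : ℝ) = Fintype.card V - #U := by
    rw [hTU, ← coe_compl, Set.ncard_coe_finset, card_compl, Nat.cast_sub (card_le_univ U)]
  rw [hcard]
  simp only [Fintype.card_fun, Fintype.card_option, Fintype.card_fin] at hU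
  push_cast at hU
  set n : ℝ := ((Fintype.card V : ℕ) : ℝ)
  have hn0 : 0 ≤ n := by positivity
  have e1 : K₀ / k ≤ η / 6 := by
    rw [div_le_iff₀ hk0]
    have : 6 * K₀ / η ≤ k := by
      have : 0 ≤ 1 / ε := by positivity
      linarith
    rw [div_le_iff₀ hη] at this
    linarith
  have e2 : k + M * (k : ℝ) ^ (s + 1) ≤ η / 6 * n := by
    rw [div_le_iff₀ hη] at hnη
    have : k + M * (k : ℝ) ^ (s + 1) ≤ B + M * (B : ℝ) ^ (s + 1) := by gcongr
    linarith
  have e3 : β ≤ η / 6 := min_le_left _ _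
  have e4 : (β + ε + K₁ * (δ + 13 * ε) + K₀ / k) * n ≤ (η / 6 * 4) * n := by
    refine mul_le_mul_of_nonneg_right ?_ hn0
    rw [mul_add]
    linarith
  have : 0 ≤ η * n := by positivity
  linarith

end SimpleGraph

end AlmostPerfectTiling

theorem theorem1p4 {W : Type*} [Fintype W] (H : SimpleGraph W)
    (r : ℕ) (hr : H.chromaticNumber = r) (hr2 : 2 ≤ r)
    (h σ ω : ℝ) (hh : h = Fintype.card W) (hσ : σ = H.minColorClassSize)
    (hω : ω = (h - σ) / (r - 1)) (η : ℝ) (hη : 0 < η) :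
    ∃ n₀ : ℕ, ∀ n : ℕ, n₀ ≤ n →
      ∀ (V : Type*) [Fintype V] (G : SimpleGraph V) [DecidableRel G.Adj],
        Fintype.card V = n →
        ∀ d : ℕ → ℕ, G.IsDegreeSequence d →
          (∀ i : ℕ, 1 ≤ i → (i : ℝ) ≤ ω * n / h →
            (1 - (ω + σ) / h) * n + σ / ω * i ≤ (d i : ℝ)) →
          ∃ T : Set G.Subgraph, SimpleGraph.IsTiling H G T ∧
            ((SimpleGraph.coveredVerts T)ᶜ.ncard : ℝ) ≤ η * n := by
  classical
  obtain ⟨s, rfl⟩ : ∃ s, r = s + 1 := ⟨r - 1, by lia⟩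
  have hs1 : 1 ≤ s := by lia
  have : NeZero s := ⟨by lia⟩
  have hs0 : (0 : ℝ) < s := by exact_mod_cast hs1
  obtain ⟨l, hl, hl0, hl1, hσ1, hσh⟩ := H.exists_bottle_labelling s hr
  -- These are the label sizes for `s` copies of `H`: `p` for `none`, `q` for each `some j`, and `M`
  -- in total.
  set p : ℝ := s * σ with hp'
  set q : ℝ := h - σ with hq'
  set c : Option (Fin s) → ℝ := FracTiling.bottleWeight none p q with hc'
  set M : ℝ := s * h with hM'
  have hσpos : 0 < σ := by rw [hσ]; exact_mod_cast hσ1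
  have hσh' : (s + 1) * σ ≤ h := by rw [hσ, hh]; exact_mod_cast hσh
  have hp : 0 < p := by positivity
  have hpq : p ≤ q := by rw [hp', hq']; linarith
  have hq : 0 < q := hp.trans_le hpq
  have hh0 : 0 < h := by linarith
  have hMpq : M = p + s * q := by rw [hM', hp', hq']; ring
  have hM : p + q ≤ M := by
    have : (1 : ℝ) ≤ s := by exact_mod_cast hs1
    rw [hMpq]
    nlinarith
  have hM0 : 0 < M := by linarith
  have hMc : M = ∑ i, c i := by
    rw [Fintype.sum_option, hMpq]
    simp [hc', FracTiling.bottleWeight]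
  have hc : ∀ i, c i = (Finset.univ.filter fun x => l x = i).card := by
    rintro (_ | j)
    · rw [hl0]
      simp [hc', FracTiling.bottleWeight, hp', hσ]
    · have h1 : ((Finset.univ.filter fun x => l x = some j).card : ℝ) + H.minColorClassSize = Fintype.card W := by
        exact_mod_cast hl1 j
      simp only [hc', FracTiling.bottleWeight, hq', hh, hσ, reduceCtorEq, if_false]
      linarith
  obtain ⟨n₀, hn₀⟩ := SimpleGraph.exists_isTiling_of_degree hl hc hc' hMc hp hpq hM hη
  -- The extra `M / q` ensures that index `1` lies in the range of the degree hypothesis.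
  refine ⟨n₀ + ⌈M / q⌉₊, fun n hn V _ G _ hV d hd hdeg => ?_⟩
  subst hV
  have hnM : M / q ≤ Fintype.card V := (Nat.le_ceil _).trans (by exact_mod_cast (by lia))
  have hωq : ω = q / s := by rw [hω]; push_cast; ring
  refine hn₀ V G (by lia) fun X hX => ?_
  refine hd.exists_le_degree hp hpq (by linarith) hnM (fun i hi1 hi2 => ?_) hX
  have e1 : (p + q) / M = (ω + σ) / h := by
    rw [hωq, hp', hM']
    field_simp
    ring
  have e2 : p / q = σ / ω := by
    rw [hωq, hp']
    field_simp
  have e3 : q / M * Fintype.card V = ω * Fintype.card V / h := by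
    rw [hωq, hM']
    field_simp
  rw [e1, e2]
  exact hdeg i hi1 (e3 ▸ hi2)
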